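/- Let $G$ be a finite complete graph each of whose edges is assigned a color (adjacent edges may receive the same color). A path or cycle in $G$ is called properly colored (PC) if any two of its edges that share an endpoint have distinct colors. Suppose that for some $k\ge 0$ there are a PC path $P$ (possibly consisting of a single vertex) and PC cycles $C_1,\dots,C_k$ in $G$ which are pairwise vertex-disjoint and whose vertex sets together cover $V(G)$ (that is, $\{P,C_1,\dots,C_k\}$ is a PC 1-path-cycle factor of $G$). Then $G$ contains a PC Hamilton path, i.e. a PC path that visits every vertex of $G$. -/

import Mathlib

/-- A subgraph `H` of an edge-colored graph `G` (the edge `e` has color `col e`) is properly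
colored if any two distinct edges of `H` that share an endpoint have distinct colors. -/
def SimpleGraph.Subgraph.IsPC {V K : Type*} {G : SimpleGraph V}
    (H : G.Subgraph) (col : G.EdgeLabeling K) : Prop :=
  ∀ e f : G.edgeSet, (e : Sym2 V) ∈ H.edgeSet → (f : Sym2 V) ∈ H.edgeSet → e ≠ f →
    (∃ v : V, v ∈ (e : Sym2 V) ∧ v ∈ (f : Sym2 V)) → col e ≠ col f

/-- A walk is properly colored if the subgraph formed by its vertices and edges is. -/
def SimpleGraph.Walk.IsPC {V K : Type*} {G : SimpleGraph V} {u v : V}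
    (p : G.Walk u v) (col : G.EdgeLabeling K) : Prop :=
  p.toSubgraph.IsPC col

/-- `{P, C 0, …, C (k - 1)}` is a properly colored 1-path-cycle factor of the edge-colored
graph `G`: `P` is a properly colored path, the `C i` are properly colored cycles, these
are pairwise vertex-disjoint, and together they cover all vertices. -/
structure SimpleGraph.IsPCPathCycleFactor {V K : Type*} {G : SimpleGraph V}
    (col : G.EdgeLabeling K) {k : ℕ} {u v : V} (P : G.Walk u v)
    {b : Fin k → V} (C : ∀ i : Fin k, G.Walk (b i) (b i)) : Prop where
  path_isPath : P.IsPath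
  path_isPC : P.IsPC col
  cycle_isCycle : ∀ i, (C i).IsCycle
  cycle_isPC : ∀ i, (C i).IsPC col
  path_cycle_disjoint : ∀ i, P.support.Disjoint (C i).support
  cycle_cycle_disjoint : ∀ i j, i ≠ j → (C i).support.Disjoint (C j).support
  spanning : ∀ x : V, x ∈ P.support ∨ ∃ i, x ∈ (C i).support

/-! The cycles are absorbed one at a time, so it suffices to merge a PC path with one disjoint PC
cycle (`HasPath.merge`). Suppose that this fails on a vertex set, and split the set into path and
cycle with the cycle as long as possible. If an edge from an end of the path to the cycle differed
in colour from the path edge at that end, the cycle could be run through in one of its two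
directions (`Pth.attach`). So each end sends edges of a single colour to the cycle, that of its path
edge. Cutting down to a stretch `x 0, …, x m` that is minimal with this property yields a `Cfg`: its
two ends are monochromatic towards the cycle, and no vertex between them repeats the colour of one
of its path edges on all its edges to the cycle.

All contradictions come from a few rearrangements: inserting the cycle into one path edge, inserting
two complementary arcs into two path edges (possibly reversing the stretch between), or exchanging
stretches of path and cycle to get a longer cycle. Their failure restricts the colours `R 1 j` to `F
1` or the colour of a nearby cycle edge. Two consecutive entries equal to the colour of the cycle
edge between them, with neighbouring cycle edges coloured `F 0`, force that colour to be `F 1`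
(`not_pair`). Then `Good.rigid` determines the picture near `x 0`: the cycle is odd, its colours
alternate between `F 1` and `F 0` except on one edge, and the rows of `x 1` and `x 2` are constant
up to one entry each.

By symmetry the same holds near `x m`. On a cycle of length at least five both ends see the same
exceptional edge, which leaves one relative position for each orientation; those two, and the
triangles, are excluded by explicit rearrangements. -/

namespace PCHam

open Set

/-! ### Properly coloured paths and cycles as integer-indexed sequences -/

variable {V κ : Type*}

/-- `Pth c n S s σ t τ`: there is a properly coloured path with `n` edges and vertex set `S`, from
`s` to `t`, whose first edge (if any) has a colour satisfying `σ` and whose last edge (if any) has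
a colour satisfying `τ`. -/
def Pth (c : V → V → κ) (n : ℤ) (S : Set V) (s : V) (σ : κ → Prop) (t : V) (τ : κ → Prop) : Prop :=
  0 ≤ n ∧ ∃ x : ℤ → V, x 0 = s ∧ x n = t ∧ InjOn x (Icc 0 n) ∧ x '' Icc 0 n = S ∧
    (∀ i, 0 ≤ i → i + 2 ≤ n → c (x i) (x (i + 1)) ≠ c (x (i + 1)) (x (i + 2))) ∧
    (1 ≤ n → σ (c (x 0) (x 1))) ∧ (1 ≤ n → τ (c (x (n - 1)) (x n)))

/-- `y` parametrises, with period `q`, a properly coloured cycle with `q` vertices. -/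
def IsCyc (c : V → V → κ) (q : ℤ) (y : ℤ → V) : Prop :=
  3 ≤ q ∧ (∀ i j, y i = y j ↔ q ∣ i - j) ∧
    ∀ i, c (y i) (y (i + 1)) ≠ c (y (i + 1)) (y (i + 2))

/-- The end predicates include `i < j`, so for a single vertex they are unsatisfiable and no colour
of an attached edge can clash there. -/
theorem Pth.seg (c : V → V → κ) (x : ℤ → V) {i j : ℤ} (hij : i ≤ j) (hinj : InjOn x (Icc i j))
    (hpc : ∀ l, i ≤ l → l + 2 ≤ j → c (x l) (x (l + 1)) ≠ c (x (l + 1)) (x (l + 2))) :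
    Pth c (j - i) (x '' Icc i j) (x i) (fun a => i < j ∧ a = c (x i) (x (i + 1)))
      (x j) (fun a => i < j ∧ a = c (x (j - 1)) (x j)) := by
  refine ⟨by omega, fun l => x (i + l), by simp, by simp, ?_, ?_, ?_, ?_, ?_⟩
  · intro a ha b hb hab
    simp only [mem_Icc] at ha hb
    have := hinj (by simp only [mem_Icc]; omega) (by simp only [mem_Icc]; omega) hab
    omega
  · ext v
    simp only [mem_image, mem_Icc]
    constructor
    · rintro ⟨l, hl, rfl⟩
      exact ⟨i + l, by omega, rfl⟩
    · rintro ⟨l, hl, rfl⟩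
      exact ⟨l - i, by omega, by congr 1; omega⟩
  · intro l hl hl2
    have := hpc (i + l) (by omega) (by omega)
    simpa only [add_assoc] using this
  · intro h
    exact ⟨by omega, by simp⟩
  · intro h
    refine ⟨by omega, ?_⟩
    simp only []
    congr 2 <;> omega

theorem Pth.reverse {c : V → V → κ} (hc : ∀ u v, c u v = c v u) {n S s σ t τ}
    (h : Pth c n S s σ t τ) : Pth c n S t τ s σ := by
  obtain ⟨hn, x, h0, h1, hinj, him, hpc, hs, ht⟩ := h
  refine ⟨hn, fun l => x (n - l), by simpa, by simpa, ?_, ?_, ?_, ?_, ?_⟩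
  · intro a ha b hb hab
    simp only [mem_Icc] at ha hb
    have := hinj (by simp only [mem_Icc]; omega) (by simp only [mem_Icc]; omega) hab
    omega
  · rw [← him]
    ext v
    simp only [mem_image, mem_Icc]
    constructor
    · rintro ⟨l, hl, rfl⟩
      exact ⟨n - l, by omega, rfl⟩
    · rintro ⟨l, hl, rfl⟩
      exact ⟨n - l, by omega, by congr 1; omega⟩
  · intro l hl hl2
    have := hpc (n - l - 2) (by omega) (by omega)
    simp only
    rw [hc (x (n - l)), hc (x (n - (l + 1))) (x (n - (l + 2)))]
    convert this.symm using 3 <;> omega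
  · intro h
    have := ht h
    rw [hc]
    convert this using 3
    omega
  · intro h
    have := hs h
    rw [hc]
    convert this using 3 <;> omega

/-- If one part is a single vertex, the connecting edge becomes the extreme edge at that end, so its
colour has to be added to the end predicate. -/
theorem Pth.join {c : V → V → κ} {n S s σ t τ n' S' s' σ' t' τ'}
    (h : Pth c n S s σ t τ) (h' : Pth c n' S' s' σ' t' τ') (hd : Disjoint S S')
    (hτ : ¬ τ (c t s')) (hσ : ¬ σ' (c t s')) :
    Pth c (n + n' + 1) (S ∪ S') s (fun a => σ a ∨ (n = 0 ∧ a = c t s'))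
      t' (fun a => τ' a ∨ (n' = 0 ∧ a = c t s')) := by
  obtain ⟨hn, x, hs, ht, hinj, him, hpc, hsc, htc⟩ := h
  obtain ⟨hn', x', hs', ht', hinj', him', hpc', hsc', htc'⟩ := h'
  set z : ℤ → V := fun i => if i ≤ n then x i else x' (i - n - 1) with hz
  have zl : ∀ i, i ≤ n → z i = x i := fun i hi => by simp [hz, hi]
  have zr : ∀ i, n < i → z i = x' (i - n - 1) := fun i hi => by simp [hz, not_le.2 hi]
  have hdis : ∀ i j, 0 ≤ i → i ≤ n → 0 ≤ j → j ≤ n' → x i ≠ x' j := by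
    intro i j hi hi' hj hj' he
    rw [← him, ← him'] at hd
    refine disjoint_left.1 hd (mem_image_of_mem x ⟨hi, hi'⟩) ?_
    rw [he]
    exact mem_image_of_mem x' ⟨hj, hj'⟩
  refine ⟨by omega, z, by rw [zl _ hn, hs], ?_, ?_, ?_, ?_, ?_, ?_⟩
  · rw [zr _ (by omega), ← ht']
    congr 1
    omega
  · intro a ha b hb hab
    simp only [mem_Icc] at ha hb
    rcases le_or_gt a n with h1 | h1 <;> rcases le_or_gt b n with h2 | h2
    · rw [zl _ h1, zl _ h2] at hab
      exact hinj ⟨ha.1, h1⟩ ⟨hb.1, h2⟩ hab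
    · rw [zl _ h1, zr _ h2] at hab
      exact absurd hab (hdis _ _ (by omega) (by omega) (by omega) (by omega))
    · rw [zr _ h1, zl _ h2] at hab
      exact absurd hab.symm (hdis _ _ (by omega) (by omega) (by omega) (by omega))
    · rw [zr _ h1, zr _ h2] at hab
      have := hinj' (by simp only [mem_Icc]; omega) (by simp only [mem_Icc]; omega) hab
      omega
  · rw [← him, ← him']
    ext v
    simp only [mem_image, mem_Icc, mem_union]
    constructor
    · rintro ⟨l, hl, rfl⟩
      rcases le_or_gt l n with h1 | h1
      · exact Or.inl ⟨l, by omega, (zl _ h1).symm⟩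
      · exact Or.inr ⟨l - n - 1, by omega, (zr _ h1).symm⟩
    · rintro (⟨l, hl, rfl⟩ | ⟨l, hl, rfl⟩)
      · exact ⟨l, by omega, zl _ (by omega)⟩
      · refine ⟨l + n + 1, by omega, ?_⟩
        rw [zr _ (by omega)]
        congr 1
        omega
  · intro i hi hi2
    rcases le_or_gt (i + 2) n with h1 | h1
    · rw [zl _ (by omega), zl _ (by omega), zl _ h1]
      exact hpc i hi h1
    rcases le_or_gt (i + 1) n with h2 | h2
    · have : i + 1 = n := by omega
      rw [zl _ (by omega), zl _ h2, zr _ h1]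
      intro he
      apply hτ
      have h3 := htc (by omega)
      rw [show n - 1 = i by omega, ← this, he, this, ht, show i + 2 - n - 1 = 0 by omega, hs'] at h3
      exact h3
    rcases le_or_gt i n with h3 | h3
    · have : i = n := by omega
      subst this
      rw [zl _ h3, zr _ h2, zr _ h1, ht, show i + 1 - i - 1 = 0 by omega,
        show i + 2 - i - 1 = 1 by omega]
      intro he
      apply hσ
      have h3 := hsc' (by omega)
      rw [← he, hs'] at h3
      exact h3
    · rw [zr _ h1, zr _ h2, zr _ h3]
      have := hpc' (i - n - 1) (by omega) (by omega)
      convert this using 3 <;> omega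
  · intro _
    rcases hn.eq_or_lt with h1 | h1
    · right
      refine ⟨h1.symm, ?_⟩
      rw [zl _ hn, zr 1 (by omega), ← h1]
      rw [← h1] at ht
      simp [ht, hs']
    · left
      rw [zl _ hn, zl _ (by omega)]
      exact hsc (by omega)
  · intro _
    rcases hn'.eq_or_lt with h1 | h1
    · right
      refine ⟨h1.symm, ?_⟩
      rw [zr (n + n' + 1) (by omega), zl _ (by omega), show n + n' + 1 - 1 = n by omega, ht,
        show n + n' + 1 - n - 1 = 0 by omega, hs']
    · left
      rw [zr _ (by omega), zr _ (by omega)]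
      have := htc' (by omega)
      convert this using 3 <;> omega

theorem Pth.close {c : V → V → κ} {n S s σ t τ} (h : Pth c n S s σ t τ) (hn2 : 2 ≤ n)
    (hσ : ¬ σ (c t s)) (hτ : ¬ τ (c t s)) : ∃ y, IsCyc c (n + 1) y ∧ range y = S := by
  obtain ⟨hn, x, hs, ht, hinj, him, hpc, hsc, htc⟩ := h
  have hpos : 0 < n + 1 := by omega
  have hb : ∀ i : ℤ, 0 ≤ i % (n + 1) ∧ i % (n + 1) ≤ n := fun i =>
    ⟨Int.emod_nonneg _ (by omega), by have := Int.emod_lt_of_pos i hpos; omega⟩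
  have hstep : ∀ i : ℤ, i % (n + 1) = n ∧ (i + 1) % (n + 1) = 0 ∨
      i % (n + 1) < n ∧ (i + 1) % (n + 1) = i % (n + 1) + 1 := by
    intro i
    rcases (hb i).2.eq_or_lt with h1 | h1
    · left
      refine ⟨h1, ?_⟩
      rw [← Int.emod_add_emod, h1, Int.emod_self]
    · right
      refine ⟨h1, ?_⟩
      rw [← Int.emod_add_emod, Int.emod_eq_of_lt (by have := hb i; omega) (by omega)]
  refine ⟨fun i => x (i % (n + 1)), ⟨by omega, ?_, ?_⟩, ?_⟩
  · intro i j
    constructor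
    · intro he
      have := hinj (hb i) (hb j) he
      exact Int.ModEq.dvd (Eq.symm this)
    · intro hd
      have : i % (n + 1) = j % (n + 1) := (Int.modEq_iff_dvd.2 hd).symm
      simp only [this]
  · intro i
    simp only
    rw [show i + 2 = i + 1 + 1 by ring]
    rcases hstep i with ⟨h1, h2⟩ | ⟨h1, h2⟩ <;> rcases hstep (i + 1) with ⟨h3, h4⟩ | ⟨h3, h4⟩
    · omega
    · rw [h4, h2, h1, zero_add, hs, ht]
      intro he
      exact hσ (by simpa only [he, hs] using hsc (by omega))
    · rw [h4, h3]
      intro he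
      rw [h2] at h3
      rw [show i % (n + 1) = n - 1 by omega, ht, hs] at he
      exact hτ (by simpa only [← he, ht] using htc (by omega))
    · rw [h4, h2]
      have := hpc (i % (n + 1)) (hb i).1 (by omega)
      rw [add_assoc]
      exact this
  · rw [← him]
    ext v
    simp only [mem_range, mem_image]
    constructor
    · rintro ⟨i, rfl⟩
      exact ⟨_, hb i, rfl⟩
    · rintro ⟨i, hi, rfl⟩
      exact ⟨i, by rw [Int.emod_eq_of_lt hi.1 (by have := hi.2; omega)]⟩

theorem IsCyc.arc {c : V → V → κ} {q : ℤ} {y : ℤ → V} (h : IsCyc c q y) {a b : ℤ} (hab : a ≤ b)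
    (h' : b < a + q) : Pth c (b - a) (y '' Icc a b) (y a) (fun k => a < b ∧ k = c (y a) (y (a + 1)))
      (y b) (fun k => a < b ∧ k = c (y (b - 1)) (y b)) := by
  refine Pth.seg c y hab ?_ (fun l _ _ => h.2.2 l)
  intro i hi j hj hij
  have h1 := (h.2.1 i j).1 hij
  simp only [mem_Icc] at hi hj
  have := Int.eq_zero_of_abs_lt_dvd h1 (by rw [abs_lt]; omega)
  omega

theorem IsCyc.image_Icc {c : V → V → κ} {q : ℤ} {y : ℤ → V} (h : IsCyc c q y) {a b : ℤ}
    (hab : b = a + q - 1) : y '' Icc a b = range y := by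
  have hq := h.1
  refine Subset.antisymm (image_subset_range _ _) ?_
  rintro _ ⟨i, rfl⟩
  refine ⟨a + (i - a) % q, ?_, ?_⟩
  · have := Int.emod_nonneg (i - a) (show q ≠ 0 by omega)
    have := Int.emod_lt_of_pos (i - a) (show 0 < q by omega)
    simp only [mem_Icc]
    omega
  · rw [h.2.1]
    have := Int.emod_add_mul_ediv (i - a) q
    exact ⟨-((i - a) / q), by linarith⟩

/-! ### Extremal configurations and their symmetries -/

/-- A properly coloured path `x lo, …, x hi` and a disjoint properly coloured cycle `y` of length
`q`, such that their union carries no properly coloured Hamilton path and no properly coloured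
1-path-cycle factor with one cycle, longer than `q`. Every edge from `x 0` to the cycle has the
colour of `x 0 x 1`, every edge from `x m` to the cycle has the colour of `x (m - 1) x m`,
and no vertex strictly between `x 0` and `x m` has either property. -/
structure Cfg (V κ : Type*) where
  c : V → V → κ
  (lo hi m q : ℤ)
  (x y : ℤ → V)
  symm : ∀ u v, c u v = c v u
  lo_le : lo ≤ 0
  le_hi : m ≤ hi
  m_pos : 1 ≤ m
  inj : InjOn x (Icc lo hi)
  pcx : ∀ i, lo ≤ i → i + 2 ≤ hi → c (x i) (x (i + 1)) ≠ c (x (i + 1)) (x (i + 2))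
  cyc : IsCyc c q y
  disj : Disjoint (x '' Icc lo hi) (range y)
  row0 : ∀ j, c (x 0) (y j) = c (x 0) (x 1)
  rowm : ∀ j, c (x m) (y j) = c (x (m - 1)) (x m)
  rowF : ∀ i, 0 < i → i < m → ∃ j, c (x i) (y j) ≠ c (x i) (x (i + 1))
  rowB : ∀ i, 0 < i → i < m → ∃ j, c (x i) (y j) ≠ c (x (i - 1)) (x i)
  noHam : ∀ n s σ t τ, ¬ Pth c n (x '' Icc lo hi ∪ range y) s σ t τ
  longest : ∀ n S s σ t τ q' y', Pth c n S s σ t τ → IsCyc c q' y' → Disjoint S (range y') →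
    S ∪ range y' = x '' Icc lo hi ∪ range y → q' ≤ q

namespace Cfg

variable (C : Cfg V κ)

/-- The colour of the `i`-th edge of the path. -/
def F (i : ℤ) : κ := C.c (C.x i) (C.x (i + 1))

/-- The colour of the `j`-th edge of the cycle. -/
def e (j : ℤ) : κ := C.c (C.y j) (C.y (j + 1))

/-- The colour of the edge from the `i`-th vertex of the path to the `j`-th one of the cycle. -/
def R (i j : ℤ) : κ := C.c (C.x i) (C.y j)

theorem three_le : 3 ≤ C.q := C.cyc.1

theorem y_eq {i j : ℤ} (h : C.q ∣ i - j) : C.y i = C.y j := (C.cyc.2.1 i j).2 h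

theorem e_eq {i j : ℤ} (h : C.q ∣ i - j) : C.e i = C.e j := by
  unfold e
  rw [C.y_eq h, C.y_eq (i := i + 1) (j := j + 1) (by simpa using h)]

theorem R_eq (l : ℤ) {i j : ℤ} (h : C.q ∣ i - j) : C.R l i = C.R l j := by
  unfold R
  rw [C.y_eq h]

@[simp] theorem e_add (i : ℤ) : C.e (i + C.q) = C.e i := C.e_eq (by simp)

theorem e_ne (i : ℤ) : C.e i ≠ C.e (i + 1) := by
  have := C.cyc.2.2 i
  unfold e
  rwa [add_assoc]

theorem F_ne {i : ℤ} (h : C.lo ≤ i) (h' : i + 2 ≤ C.hi) : C.F i ≠ C.F (i + 1) := by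
  have := C.pcx i h h'
  unfold F
  rwa [add_assoc]

theorem R_zero (j : ℤ) : C.R 0 j = C.F 0 := C.row0 j

theorem R_m (j : ℤ) : C.R C.m j = C.F (C.m - 1) := by
  unfold R F
  rw [C.rowm, sub_add_cancel]

theorem exists_R_ne_F {i : ℤ} (h : 0 < i) (h' : i < C.m) : ∃ j, C.R i j ≠ C.F i :=
  C.rowF i h h'

theorem exists_R_ne_B {i : ℤ} (h : 0 < i) (h' : i < C.m) : ∃ j, C.R i j ≠ C.F (i - 1) := by
  obtain ⟨j, hj⟩ := C.rowB i h h'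
  refine ⟨j, ?_⟩
  unfold R F
  rwa [sub_add_cancel]

/-- Rotation of the cycle. -/
def shift (t : ℤ) : Cfg V κ :=
  have hr : range (fun j => C.y (j + t)) = range C.y := (Equiv.addRight t).surjective.range_comp C.y
  { C with
    y := fun j => C.y (j + t)
    cyc := by
      refine ⟨C.cyc.1, fun i j => ?_, fun i => ?_⟩
      · rw [C.cyc.2.1, add_sub_add_right_eq_sub]
      · have := C.cyc.2.2 (i + t)
        simpa only [add_right_comm] using this
    disj := by rw [hr]; exact C.disj
    row0 := fun j => C.row0 _
    rowm := fun j => C.rowm _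
    rowF := fun i h h' => by
      obtain ⟨j, hj⟩ := C.rowF i h h'
      exact ⟨j - t, by simpa using hj⟩
    rowB := fun i h h' => by
      obtain ⟨j, hj⟩ := C.rowB i h h'
      exact ⟨j - t, by simpa using hj⟩
    noHam := by rw [hr]; exact C.noHam
    longest := by rw [hr]; exact C.longest }

/-- Reflection of the cycle that interchanges `y 0` and `y 1`. -/
def refl : Cfg V κ :=
  have hr : range (fun j => C.y (1 - j)) = range C.y :=
    (Equiv.subLeft 1).surjective.range_comp C.y
  { C with
    y := fun j => C.y (1 - j)
    cyc := by
      refine ⟨C.cyc.1, fun i j => ?_, fun i => ?_⟩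
      · rw [C.cyc.2.1, ← dvd_neg]
        ring_nf
      · have := C.cyc.2.2 (1 - (i + 2))
        rw [C.symm (C.y (1 - i)), C.symm (C.y (1 - (i + 1))) (C.y (1 - (i + 2)))]
        convert this.symm using 3 <;> ring_nf
    disj := by rw [hr]; exact C.disj
    row0 := fun j => C.row0 _
    rowm := fun j => C.rowm _
    rowF := fun i h h' => by
      obtain ⟨j, hj⟩ := C.rowF i h h'
      exact ⟨1 - j, by simpa using hj⟩
    rowB := fun i h h' => by
      obtain ⟨j, hj⟩ := C.rowB i h h'
      exact ⟨1 - j, by simpa using hj⟩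
    noHam := by rw [hr]; exact C.noHam
    longest := by rw [hr]; exact C.longest }

/-- Reversal of the path. -/
def flip : Cfg V κ :=
  have hr : (fun i => C.x (C.m - i)) '' Icc (C.m - C.hi) (C.m - C.lo) =
      C.x '' Icc C.lo C.hi := by
    rw [← image_const_sub_Icc, image_image]
    simp
  { C with
    lo := C.m - C.hi
    hi := C.m - C.lo
    x := fun i => C.x (C.m - i)
    lo_le := by have := C.le_hi; omega
    le_hi := by have := C.lo_le; omega
    inj := by
      intro a ha b hb h
      simp only [mem_Icc] at ha hb
      have := C.inj (by simp only [mem_Icc]; omega) (by simp only [mem_Icc]; omega) h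
      omega
    pcx := by
      intro i h h'
      have := C.pcx (C.m - (i + 2)) (by omega) (by omega)
      rw [C.symm (C.x (C.m - i)), C.symm (C.x (C.m - (i + 1)))  (C.x (C.m - (i + 2)))]
      convert this.symm using 3 <;> ring_nf
    disj := by rw [hr]; exact C.disj
    row0 := fun j => by
      rw [sub_zero, C.rowm, C.symm]
    rowm := fun j => by
      rw [sub_self, C.row0, C.symm, sub_sub_cancel]
    rowF := fun i h h' => by
      obtain ⟨j, hj⟩ := C.rowB (C.m - i) (by omega) (by omega)
      refine ⟨j, ?_⟩
      rwa [C.symm (C.x (C.m - i)) (C.x (C.m - (i + 1))), ← sub_sub]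
    rowB := fun i h h' => by
      obtain ⟨j, hj⟩ := C.rowF (C.m - i) (by omega) (by omega)
      refine ⟨j, ?_⟩
      rwa [C.symm (C.x (C.m - (i - 1))) (C.x (C.m - i)), show C.m - (i - 1) = C.m - i + 1 by ring]
    noHam := by rw [hr]; exact C.noHam
    longest := by rw [hr]; exact C.longest }

@[simp] theorem shift_F (t i : ℤ) : (C.shift t).F i = C.F i := rfl
@[simp] theorem shift_R (t i j : ℤ) : (C.shift t).R i j = C.R i (j + t) := rfl
@[simp] theorem shift_e (t j : ℤ) : (C.shift t).e j = C.e (j + t) := by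
  change C.c (C.y (j + t)) (C.y (j + 1 + t)) = _
  rw [add_right_comm]
  rfl
@[simp] theorem shift_lo (t : ℤ) : (C.shift t).lo = C.lo := rfl
@[simp] theorem shift_hi (t : ℤ) : (C.shift t).hi = C.hi := rfl
@[simp] theorem shift_m (t : ℤ) : (C.shift t).m = C.m := rfl
@[simp] theorem shift_q (t : ℤ) : (C.shift t).q = C.q := rfl
@[simp] theorem refl_F (i : ℤ) : C.refl.F i = C.F i := rfl
@[simp] theorem refl_R (i j : ℤ) : C.refl.R i j = C.R i (1 - j) := rfl
@[simp] theorem refl_e (j : ℤ) : C.refl.e j = C.e (-j) := by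
  change C.c (C.y (1 - j)) (C.y (1 - (j + 1))) = _
  rw [C.symm, show 1 - (j + 1) = -j by ring, show 1 - j = -j + 1 by ring]
  rfl
@[simp] theorem refl_lo : C.refl.lo = C.lo := rfl
@[simp] theorem refl_hi : C.refl.hi = C.hi := rfl
@[simp] theorem refl_m : C.refl.m = C.m := rfl
@[simp] theorem refl_q : C.refl.q = C.q := rfl
@[simp] theorem flip_F (i : ℤ) : C.flip.F i = C.F (C.m - 1 - i) := by
  change C.c (C.x (C.m - i)) (C.x (C.m - (i + 1))) = _
  rw [C.symm, show C.m - (i + 1) = C.m - 1 - i by ring, show C.m - i = C.m - 1 - i + 1 by ring]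
  rfl
@[simp] theorem flip_R (i j : ℤ) : C.flip.R i j = C.R (C.m - i) j := rfl
@[simp] theorem flip_e (j : ℤ) : C.flip.e j = C.e j := rfl
@[simp] theorem flip_lo : C.flip.lo = C.m - C.hi := rfl
@[simp] theorem flip_hi : C.flip.hi = C.m - C.lo := rfl
@[simp] theorem flip_m : C.flip.m = C.m := rfl
@[simp] theorem flip_q : C.flip.q = C.q := rfl

/-! ### Segments of the path and arcs of the cycle -/

theorem seg {a b : ℤ} (h : C.lo ≤ a) (hab : a ≤ b) (h' : b ≤ C.hi) :
    Pth C.c (b - a) (C.x '' Icc a b) (C.x a) (fun k => a < b ∧ k = C.F a)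
      (C.x b) (fun k => a < b ∧ k = C.F (b - 1)) := by
  have := Pth.seg C.c C.x hab (C.inj.mono (Icc_subset_Icc h h'))
    (fun l hl hl' => C.pcx l (by omega) (by omega))
  unfold F
  rwa [sub_add_cancel]

theorem arc {a b : ℤ} (hab : a ≤ b) (h' : b < a + C.q) :
    Pth C.c (b - a) (C.y '' Icc a b) (C.y a) (fun k => a < b ∧ k = C.e a)
      (C.y b) (fun k => a < b ∧ k = C.e (b - 1)) := by
  have := C.cyc.arc hab h'
  unfold e
  rwa [sub_add_cancel]

theorem arc' {a b : ℤ} (hab : a ≤ b) (h' : b < a + C.q) :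
    Pth C.c (b - a) (C.y '' Icc a b) (C.y b) (fun k => a < b ∧ k = C.e (b - 1))
      (C.y a) (fun k => a < b ∧ k = C.e a) :=
  (C.arc hab h').reverse C.symm

theorem arc_full {a b : ℤ} (h : b = a + C.q - 1) : C.y '' Icc a b = range C.y :=
  C.cyc.image_Icc h

theorem arc_union {a b a' b' : ℤ} (hab : a ≤ b) (ha' : a' = b + 1) (hb : a' ≤ b')
    (hb' : b' = a + C.q - 1) : C.y '' Icc a b ∪ C.y '' Icc a' b' = range C.y := by
  rw [← image_union, ← C.arc_full hb']
  congr 1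
  ext
  simp only [mem_union, mem_Icc]
  omega

theorem arc_disjoint {a b a' b' : ℤ} (ha' : b < a') (hb' : b' < a + C.q) :
    Disjoint (C.y '' Icc a b) (C.y '' Icc a' b') := by
  rw [disjoint_left]
  rintro _ ⟨i, hi, rfl⟩ ⟨j, hj, hij⟩
  have h1 := (C.cyc.2.1 j i).1 hij
  simp only [mem_Icc] at hi hj
  have := Int.eq_zero_of_abs_lt_dvd h1 (by rw [abs_lt]; omega)
  omega

theorem seg_disjoint {a b a' b' : ℤ} (h : C.lo ≤ a) (ha' : b < a') (hb' : b' ≤ C.hi) :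
    Disjoint (C.x '' Icc a b) (C.x '' Icc a' b') := by
  rw [disjoint_left]
  rintro _ ⟨i, hi, rfl⟩ ⟨j, hj, hij⟩
  simp only [mem_Icc] at hi hj
  have := C.inj (by simp only [mem_Icc]; omega) (by simp only [mem_Icc]; omega) hij
  omega

theorem seg_union {a b d : ℤ} (hab : a ≤ b + 1) (hb : b ≤ d) :
    C.x '' Icc a d = C.x '' Icc a b ∪ C.x '' Icc (b + 1) d := by
  rw [← image_union]
  congr 1
  ext
  simp only [mem_union, mem_Icc]
  omega

theorem seg_disjoint_cyc {a b : ℤ} (h : C.lo ≤ a) (h' : b ≤ C.hi) {A : Set V}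
    (hA : A ⊆ range C.y) : Disjoint (C.x '' Icc a b) A :=
  C.disj.mono (image_mono (Icc_subset_Icc h h')) hA

/-! ### Rearrangements of the path and the cycle -/

theorem not_pth {n S s σ t τ} (h : Pth C.c n S s σ t τ)
    (hS : S = C.x '' Icc C.lo C.hi ∪ range C.y) : False :=
  C.noHam n s σ t τ (hS ▸ h)

/-- The block has at least one edge (`hn`), so the two connecting edges do not meet and need not be
compared. -/
theorem insert_block {n s σ t τ} (hA : Pth C.c n (range C.y) (C.y s) σ (C.y t) τ) {i : ℤ}
    (hi : C.lo ≤ i) (hi' : i + 1 ≤ C.hi) (hn : 1 ≤ n)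
    (h1 : C.lo < i → C.R i s ≠ C.F (i - 1)) (h2 : ¬ σ (C.R i s))
    (h3 : i + 1 < C.hi → C.R (i + 1) t ≠ C.F (i + 1)) (h4 : ¬ τ (C.R (i + 1) t)) : False := by
  have hU := C.seg le_rfl hi (show i ≤ C.hi by omega)
  have hD := C.seg (show C.lo ≤ i + 1 by omega) hi' le_rfl
  have j1 := hU.join hA (C.seg_disjoint_cyc le_rfl (by omega) (subset_refl _))
    (fun h => h1 h.1 h.2) h2
  have j2 := j1.join hD ?_ ?_ ?_
  · refine C.not_pth j2 ?_
    rw [C.seg_union (show C.lo ≤ i + 1 by omega) (show i ≤ C.hi by omega)]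
    ac_rfl
  · rw [disjoint_union_left]
    exact ⟨C.seg_disjoint le_rfl (by omega) le_rfl,
      (C.seg_disjoint_cyc (by omega) le_rfl (subset_refl _)).symm⟩
  · rw [C.symm]
    rintro (h | ⟨h, h'⟩)
    · exact h4 h
    · omega
  · rw [C.symm]
    exact fun h => h3 h.1 h.2

/-- The Hamilton path runs `…, x i`, block, `x (i + 1), …, x j`, block, `x (j + 1), …`. The
hypotheses list the possible clashes at the four junctions; `h5`, `h10` and `h11` matter when a
block or the middle stretch is a single vertex. -/
theorem insert_two_blocks {n A s σ t τ n' A' s' σ' t' τ'} (hA : Pth C.c n A (C.y s) σ (C.y t) τ)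
    (hA' : Pth C.c n' A' (C.y s') σ' (C.y t') τ') (hd : Disjoint A A') (hU : A ∪ A' = range C.y)
    {i j : ℤ} (hi : C.lo ≤ i) (hij : i < j) (hj : j + 1 ≤ C.hi)
    (h1 : C.lo < i → C.R i s ≠ C.F (i - 1)) (h2 : ¬ σ (C.R i s))
    (h3 : i + 1 < j → C.R (i + 1) t ≠ C.F (i + 1)) (h4 : ¬ τ (C.R (i + 1) t))
    (h5 : n = 0 → C.R i s ≠ C.R (i + 1) t)
    (h6 : i + 1 < j → C.R j s' ≠ C.F (j - 1)) (h7 : ¬ σ' (C.R j s'))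
    (h8 : j + 1 < C.hi → C.R (j + 1) t' ≠ C.F (j + 1)) (h9 : ¬ τ' (C.R (j + 1) t'))
    (h10 : n' = 0 → C.R j s' ≠ C.R (j + 1) t')
    (h11 : i + 1 = j → C.R j t ≠ C.R j s') : False := by
  have hAC : A ⊆ range C.y := hU ▸ subset_union_left
  have hAC' : A' ⊆ range C.y := hU ▸ subset_union_right
  have j1 := (C.seg le_rfl hi (show i ≤ C.hi by omega)).join hA
    (C.seg_disjoint_cyc le_rfl (by omega) hAC) (fun h => h1 h.1 h.2) h2
  have j2 := j1.join (C.seg (show C.lo ≤ i + 1 by omega) (show i + 1 ≤ j by omega) (by omega))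
    ?_ ?_ ?_
  have j3 := j2.join hA' ?_ ?_ ?_
  have j4 := j3.join (C.seg (show C.lo ≤ j + 1 by omega) hj le_rfl) ?_ ?_ ?_
  · refine C.not_pth j4 ?_
    rw [C.seg_union (a := C.lo) (b := j) (d := C.hi) (by omega) (by omega),
      C.seg_union (a := C.lo) (b := i) (d := j) (by omega) (by omega), ← hU]
    ac_rfl
  · simp only [disjoint_union_left]
    refine ⟨⟨⟨?_, ?_⟩, ?_⟩, ?_⟩
    · exact C.seg_disjoint le_rfl (by omega) le_rfl
    · exact (C.seg_disjoint_cyc (by omega) le_rfl hAC).symm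
    · exact C.seg_disjoint (by omega) (by omega) le_rfl
    · exact (C.seg_disjoint_cyc (by omega) le_rfl hAC').symm
  · rw [C.symm]
    rintro (h | ⟨h, h'⟩)
    · exact h9 h
    · exact h10 h h'.symm
  · rw [C.symm]
    exact fun h => h8 h.1 h.2
  · simp only [disjoint_union_left]
    refine ⟨⟨?_, hd⟩, ?_⟩
    · exact C.seg_disjoint_cyc (by omega) (by omega) hAC'
    · exact C.seg_disjoint_cyc (by omega) (by omega) hAC'
  · rintro (h | ⟨h, h'⟩)
    · exact h6 h.1 h.2
    · refine h11 (by omega) ?_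
      rw [C.symm (C.y t), show i + 1 = j by omega] at h'
      exact h'.symm
  · exact h7
  · simp only [disjoint_union_left]
    refine ⟨?_, (C.seg_disjoint_cyc (by omega) (by omega) hAC).symm⟩
    exact C.seg_disjoint (by omega) (by omega) (by omega)
  · rw [C.symm]
    rintro (h | ⟨h, h'⟩)
    · exact h4 h
    · exact h5 h h'.symm
  · rw [C.symm]
    exact fun h => h3 h.1 h.2

/-- As for two blocks, but the middle stretch is traversed backwards: `…, x i`, block, `x j, …, x (i
+ 1)`, block, `x (j + 1), …`. -/
theorem insert_two_blocks_reverse {n A s σ t τ n' A' s' σ' t' τ'}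
    (hA : Pth C.c n A (C.y s) σ (C.y t) τ)
    (hA' : Pth C.c n' A' (C.y s') σ' (C.y t') τ') (hd : Disjoint A A') (hU : A ∪ A' = range C.y)
    {i j : ℤ} (hi : C.lo ≤ i) (hij : i + 1 < j) (hj : j + 1 ≤ C.hi)
    (h1 : C.lo < i → C.R i s ≠ C.F (i - 1)) (h2 : ¬ σ (C.R i s))
    (h3 : C.R j t ≠ C.F (j - 1)) (h4 : ¬ τ (C.R j t))
    (h5 : n = 0 → C.R i s ≠ C.R j t)
    (h6 : C.R (i + 1) s' ≠ C.F (i + 1)) (h7 : ¬ σ' (C.R (i + 1) s'))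
    (h8 : j + 1 < C.hi → C.R (j + 1) t' ≠ C.F (j + 1)) (h9 : ¬ τ' (C.R (j + 1) t'))
    (h10 : n' = 0 → C.R (i + 1) s' ≠ C.R (j + 1) t') : False := by
  have hAC : A ⊆ range C.y := hU ▸ subset_union_left
  have hAC' : A' ⊆ range C.y := hU ▸ subset_union_right
  have j1 := (C.seg le_rfl hi (show i ≤ C.hi by omega)).join hA
    (C.seg_disjoint_cyc le_rfl (by omega) hAC) (fun h => h1 h.1 h.2) h2
  have j2 := j1.join ((C.seg (show C.lo ≤ i + 1 by omega) (show i + 1 ≤ j by omega)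
    (by omega)).reverse C.symm) ?_ ?_ ?_
  have j3 := j2.join hA' ?_ ?_ ?_
  have j4 := j3.join (C.seg (show C.lo ≤ j + 1 by omega) hj le_rfl) ?_ ?_ ?_
  · refine C.not_pth j4 ?_
    rw [C.seg_union (a := C.lo) (b := j) (d := C.hi) (by omega) (by omega),
      C.seg_union (a := C.lo) (b := i) (d := j) (by omega) (by omega), ← hU]
    ac_rfl
  · simp only [disjoint_union_left]
    refine ⟨⟨⟨?_, ?_⟩, ?_⟩, ?_⟩
    · exact C.seg_disjoint le_rfl (by omega) le_rfl
    · exact (C.seg_disjoint_cyc (by omega) le_rfl hAC).symm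
    · exact C.seg_disjoint (by omega) (by omega) le_rfl
    · exact (C.seg_disjoint_cyc (by omega) le_rfl hAC').symm
  · rw [C.symm]
    rintro (h | ⟨h, h'⟩)
    · exact h9 h
    · exact h10 h h'.symm
  · rw [C.symm]
    exact fun h => h8 h.1 h.2
  · simp only [disjoint_union_left]
    refine ⟨⟨?_, hd⟩, ?_⟩
    · exact C.seg_disjoint_cyc (by omega) (by omega) hAC'
    · exact C.seg_disjoint_cyc (by omega) (by omega) hAC'
  · rintro (h | ⟨h, h'⟩)
    · exact h6 h.2
    · omega
  · exact h7
  · simp only [disjoint_union_left]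
    refine ⟨?_, (C.seg_disjoint_cyc (by omega) (by omega) hAC).symm⟩
    exact C.seg_disjoint (by omega) (by omega) (by omega)
  · rw [C.symm]
    rintro (h | ⟨h, h'⟩)
    · exact h4 h
    · exact h5 h h'.symm
  · rw [C.symm]
    exact fun h => h3 h.2

/-- The first block replaces `x (i + 1), …, x j` in the path, and these vertices close up with the
second block to a cycle of length `j - i + n' + 1`. By `hq` this contradicts the maximality of `q`.
-/
theorem exchange_blocks {n A s σ t τ n' A' s' σ' t' τ'} (hA : Pth C.c n A (C.y s) σ (C.y t) τ)
    (hA' : Pth C.c n' A' (C.y s') σ' (C.y t') τ') (hd : Disjoint A A') (hU : A ∪ A' = range C.y)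
    {i j : ℤ} (hi : C.lo ≤ i) (hij : i + 1 < j) (hj : j + 1 ≤ C.hi) (hq : C.q < j - i + n' + 1)
    (h1 : C.lo < i → C.R i s ≠ C.F (i - 1)) (h2 : ¬ σ (C.R i s))
    (h3 : j + 1 < C.hi → C.R (j + 1) t ≠ C.F (j + 1)) (h4 : ¬ τ (C.R (j + 1) t))
    (h5 : n = 0 → C.R i s ≠ C.R (j + 1) t)
    (h6 : C.R j s' ≠ C.F (j - 1)) (h7 : ¬ σ' (C.R j s'))
    (h8 : C.R (i + 1) t' ≠ C.F (i + 1)) (h9 : ¬ τ' (C.R (i + 1) t'))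
    (h10 : n' = 0 → C.R j s' ≠ C.R (i + 1) t') : False := by
  have hAC : A ⊆ range C.y := hU ▸ subset_union_left
  have hAC' : A' ⊆ range C.y := hU ▸ subset_union_right
  have hn' := hA'.1
  have j1 := (C.seg le_rfl hi (show i ≤ C.hi by omega)).join hA
    (C.seg_disjoint_cyc le_rfl (by omega) hAC) (fun h => h1 h.1 h.2) h2
  have j2 := j1.join (C.seg (show C.lo ≤ j + 1 by omega) hj le_rfl) ?_ ?_ ?_
  have j3 := (C.seg (show C.lo ≤ i + 1 by omega) (show i + 1 ≤ j by omega) (by omega)).join hA'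
    (C.seg_disjoint_cyc (by omega) (by omega) hAC') (fun h => h6 h.2) h7
  have hs1 : C.c (C.y t') (C.x (i + 1)) = C.R (i + 1) t' := C.symm _ _
  obtain ⟨y', hy', hr⟩ := j3.close (by omega)
    (by rw [hs1]; rintro (h | ⟨h, h'⟩); exacts [h8 h.2, by omega])
    (by rw [hs1]; rintro (h | ⟨h, h'⟩); exacts [h9 h, h10 h h'.symm])
  · have := C.longest _ _ _ _ _ _ _ y' j2 hy' ?_ ?_
    · omega
    · rw [hr]
      rw [disjoint_union_right]
      simp only [disjoint_union_left]
      refine ⟨⟨⟨?_, ?_⟩, ?_⟩, ⟨?_, hd⟩, ?_⟩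
      · exact C.seg_disjoint le_rfl (by omega) (by omega)
      · exact (C.seg_disjoint_cyc (by omega) (by omega) hAC).symm
      · exact (C.seg_disjoint (by omega) (by omega) le_rfl).symm
      · exact C.seg_disjoint_cyc (by omega) (by omega) hAC'
      · exact C.seg_disjoint_cyc (by omega) (by omega) hAC'
    · rw [hr, C.seg_union (a := C.lo) (b := j) (d := C.hi) (by omega) (by omega),
        C.seg_union (a := C.lo) (b := i) (d := j) (by omega) (by omega), ← hU]
      ac_rfl
  · simp only [disjoint_union_left]
    refine ⟨?_, (C.seg_disjoint_cyc (by omega) (by omega) hAC).symm⟩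
    exact C.seg_disjoint (by omega) (by omega) (by omega)
  · rw [C.symm]
    rintro (h | ⟨h, h'⟩)
    · exact h4 h
    · exact h5 h h'.symm
  · rw [C.symm]
    exact fun h => h3 h.1 h.2

/-- The cycle cannot be inserted into the edge `x i x (i + 1)` with the edge from `y (s - 1)` to
`y s` removed. -/
theorem insert_cycle {i s : ℤ} (hi : C.lo ≤ i) (hi' : i + 1 ≤ C.hi)
    (h1 : C.lo < i → C.R i s ≠ C.F (i - 1)) (h2 : C.R i s ≠ C.e s)
    (h3 : i + 1 < C.hi → C.R (i + 1) (s - 1) ≠ C.F (i + 1))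
    (h4 : C.R (i + 1) (s - 1) ≠ C.e (s - 2)) : False := by
  have hq := C.three_le
  have h := C.arc (a := s) (b := s + C.q - 1) (by omega) (by omega)
  rw [C.arc_full rfl] at h
  have e1 : C.R (i + 1) (s + C.q - 1) = C.R (i + 1) (s - 1) := C.R_eq _ ⟨1, by ring⟩
  have e2 : C.e (s + C.q - 1 - 1) = C.e (s - 2) := C.e_eq ⟨1, by ring⟩
  refine C.insert_block h hi hi' (by omega) h1 (fun h => h2 h.2) ?_ ?_
  · rwa [e1]
  · rw [e1, e2]
    exact fun h => h4 h.2

theorem insert_cycle' {i s : ℤ} (hi : C.lo ≤ i) (hi' : i + 1 ≤ C.hi)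
    (h1 : C.lo < i → C.R i s ≠ C.F (i - 1)) (h2 : C.R i s ≠ C.e (s - 1))
    (h3 : i + 1 < C.hi → C.R (i + 1) (s + 1) ≠ C.F (i + 1))
    (h4 : C.R (i + 1) (s + 1) ≠ C.e (s + 1)) : False := by
  refine C.refl.insert_cycle (i := i) (s := 1 - s) hi hi' ?_ ?_ ?_ ?_ <;>
    simp only [refl_R, refl_F, refl_e, refl_lo, refl_hi] <;> ring_nf at * <;> assumption

/-! ### Colours next to the end of a monochromatic row -/

theorem F_zero_ne_pred (h : C.lo < 0) : C.F 0 ≠ C.F (0 - 1) := by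
  have := C.F_ne (i := 0 - 1) (by omega) (by have := C.le_hi; have := C.m_pos; omega)
  rw [sub_add_cancel] at this
  exact this.symm

theorem F_pred_m_ne (h : C.m < C.hi) : C.F (C.m - 1) ≠ C.F C.m := by
  have := C.F_ne (i := C.m - 1) (by have := C.lo_le; have := C.m_pos; omega) (by omega)
  rwa [sub_add_cancel] at this

/-- Otherwise `x 0` and `x 1` see the whole cycle in colour `F 0`, so the cycle fits between them as
soon as `e s` and `e (s - 2)` differ from `F 0`. If `e t = F 0`, then `s = t + 1` works, since
adjacent cycle edges differ. -/
theorem m_ne_one : C.m ≠ 1 := by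
  intro hm
  have h1 : ∀ j, C.R 1 j = C.F 0 := fun j => by
    have := C.R_m j
    rwa [hm] at this
  have key : ∀ s, C.F 0 ≠ C.e s → C.F 0 ≠ C.e (s - 2) → False := by
    intro s hs hs'
    refine C.insert_cycle (i := 0) (s := s) C.lo_le (by have := C.le_hi; omega) ?_ ?_ ?_ ?_
    · rw [C.R_zero]
      exact C.F_zero_ne_pred
    · rwa [C.R_zero]
    · intro h
      rw [zero_add, h1]
      have := C.F_pred_m_ne (by omega)
      rwa [hm] at this
    · rwa [zero_add, h1]
  by_cases h : ∃ t, C.e t = C.F 0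
  · obtain ⟨t, ht⟩ := h
    have e1 := C.e_ne t
    have e2 := C.e_ne (t - 1)
    rw [sub_add_cancel] at e2
    refine key (t + 1) (ht ▸ e1) ?_
    rw [show t + 1 - 2 = t - 1 by ring, ← ht]
    exact e2.symm
  · push Not at h
    exact key 0 (h _).symm (h _).symm

theorem two_le_m : 2 ≤ C.m := by
  have := C.m_pos
  have := C.m_ne_one
  omega

theorem two_le_hi : 2 ≤ C.hi := C.two_le_m.trans C.le_hi

theorem F_zero_ne_one : C.F 0 ≠ C.F 1 :=
  C.F_ne (i := 0) C.lo_le (by simpa using C.two_le_hi)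

/-- Inserting the cycle between `x 0` and `x 1`, entering at `y (j + 1)` and leaving at `y j`, can
only be obstructed at `x 1` or at `y j`. -/
theorem row_one {j : ℤ} (h : C.e (j + 1) ≠ C.F 0) : C.R 1 j = C.F 1 ∨ C.R 1 j = C.e (j - 1) := by
  by_contra! hc
  refine C.insert_cycle (i := 0) (s := j + 1) C.lo_le (by have := C.two_le_hi; omega) ?_ ?_ ?_ ?_
  · rw [C.R_zero]
    exact C.F_zero_ne_pred
  · rw [C.R_zero]
    exact h.symm
  · rw [add_sub_cancel_right]
    exact fun _ => hc.1
  · rw [add_sub_cancel_right, show j + 1 - 2 = j - 1 by ring]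
    exact hc.2

theorem row_one' {j : ℤ} (h : C.e (j - 2) ≠ C.F 0) : C.R 1 j = C.F 1 ∨ C.R 1 j = C.e j := by
  have := C.refl.row_one (j := 1 - j) (by
    rw [refl_e, refl_F]
    convert h using 3
    ring)
  simp only [refl_R, refl_F, refl_e] at this
  rwa [show 1 - (1 - j) = j by ring, show -(1 - j - 1) = j by ring] at this

theorem row_pred_m {j : ℤ} (h : C.e (j + 1) ≠ C.F (C.m - 1)) :
    C.R (C.m - 1) j = C.F (C.m - 2) ∨ C.R (C.m - 1) j = C.e (j - 1) := by
  have := C.flip.row_one (j := j) (by simpa using h)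
  simpa [sub_sub] using this

theorem row_pred_m' {j : ℤ} (h : C.e (j - 2) ≠ C.F (C.m - 1)) :
    C.R (C.m - 1) j = C.F (C.m - 2) ∨ C.R (C.m - 1) j = C.e j := by
  have := C.flip.row_one' (j := j) (by simpa using h)
  simpa [sub_sub] using this

theorem F_pred_pred_m_ne : C.F (C.m - 2) ≠ C.F (C.m - 1) := by
  have := C.flip.F_zero_ne_one
  simpa [sub_sub] using this.symm

/-! ### Pairs of equal colours -/

/-- The edge `y 0 y 1` and the two edges joining it to `x 1` have the same colour, different from
that of `x 1 x 2`, and both edges of the cycle adjacent to `y 0 y 1` have the colour of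
`x 0 x 1`. -/
structure Pair : Prop where
  e_neg : C.e (-1) = C.F 0
  e_one : C.e 1 = C.F 0
  R_zero : C.R 1 0 = C.e 0
  R_one : C.R 1 1 = C.e 0
  ne : C.e 0 ≠ C.F 1

variable {C}

theorem Pair.ne' (h : C.Pair) : C.e 0 ≠ C.F 0 := h.e_one ▸ C.e_ne 0

theorem Pair.refl (h : C.Pair) : C.refl.Pair := by
  constructor <;> simp [h.e_neg, h.e_one, h.R_zero, h.R_one, h.ne]

theorem Pair.m_ne_two (h : C.Pair) : C.m ≠ 2 := by
  intro hm
  have hi := C.two_le_hi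
  have hr : C.R (1 + 1) (0 + 1) = C.F 1 := by
    have := C.R_m 1
    rwa [hm] at this
  refine C.insert_cycle' (i := 1) (s := 0) (by have := C.lo_le; omega) (by omega) ?_ ?_ ?_ ?_
  · rw [h.R_zero]
    exact fun _ => h.ne'
  · rw [h.R_zero]
    exact h.e_neg ▸ h.ne'
  · rw [hr]
    intro hi2
    exact C.F_ne (i := 1) (by have := C.lo_le; omega) (by omega)
  · rw [hr, zero_add, h.e_one]
    exact C.F_zero_ne_one.symm

/-- The arc `y (j + 1), …, y q = y 0` goes between `x 0` and `x 1`, and `y j, …, y 1` between `x (m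
- 1)` and `x m`. -/
theorem Pair.false_of_split (h : C.Pair) (hm : 3 ≤ C.m) (hne : C.F 0 ≠ C.F (C.m - 1))
    {j : ℤ} (hj : 1 ≤ j) (hj' : j < C.q) (h1 : C.e (j + 1) ≠ C.F 0)
    (h2 : C.R (C.m - 1) j ≠ C.F (C.m - 2)) (h3 : 1 < j → C.R (C.m - 1) j ≠ C.e (j - 1))
    (h4 : j = 1 → C.R (C.m - 1) j ≠ C.F (C.m - 1)) : False := by
  have hmh := C.le_hi
  have hlo := C.lo_le
  have hq := C.three_le
  have eq1 : C.e (C.q - 1) = C.F 0 := by rw [← h.e_neg]; exact C.e_eq ⟨1, by ring⟩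
  have rq : C.R (0 + 1) C.q = C.e 0 := by rw [← h.R_zero]; exact C.R_eq _ ⟨1, by ring⟩
  have rm : C.R (C.m - 1 + 1) 1 = C.F (C.m - 1) := by rw [sub_add_cancel]; exact C.R_m 1
  refine C.insert_two_blocks (C.arc (a := j + 1) (b := C.q) (by omega) (by omega))
    (C.arc' (a := 1) (b := j) (by omega) (by omega)) ?_ ?_ (i := 0) (j := C.m - 1) hlo
    (by omega) (by omega) ?_ ?_ ?_ ?_ ?_ ?_ ?_ ?_ ?_ ?_ ?_
  · exact (C.arc_disjoint (by omega) (by omega)).symm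
  · rw [union_comm]
    exact C.arc_union (by omega) (by omega) (by omega) (by omega)
  · rw [C.R_zero]
    exact C.F_zero_ne_pred
  · rw [C.R_zero]
    exact fun h => h1 h.2.symm
  · rw [rq]
    exact fun _ => h.ne
  · rw [rq, eq1]
    exact fun h' => h.ne' h'.2
  · rw [rq, C.R_zero]
    exact fun _ => h.ne'.symm
  · rw [sub_sub]
    exact fun _ => h2
  · exact fun h => h3 h.1 h.2
  · rw [rm]
    intro hi
    rw [sub_add_cancel]
    exact C.F_pred_m_ne (by omega)
  · rw [rm, h.e_one]
    exact fun h => hne h.2.symm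
  · intro hj
    rw [show j = 1 by omega, rm]
    have := h4 (by omega)
    rwa [show j = 1 by omega] at this
  · omega

theorem Pair.row_pred_m_of_two_le (h : C.Pair) (hm : 3 ≤ C.m) (hne : C.F 0 ≠ C.F (C.m - 1))
    {j : ℤ} (hj : 2 ≤ j) (hj' : j < C.q) :
    C.R (C.m - 1) j = C.F (C.m - 2) ∨ C.R (C.m - 1) j = C.e (j - 1) := by
  by_cases h1 : C.e (j + 1) = C.F (C.m - 1)
  · by_contra! hc
    exact h.false_of_split hm hne (by omega) hj' (h1 ▸ hne.symm) hc.1 (fun _ => hc.2)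
      (fun _ => by omega)
  · exact C.row_pred_m h1

theorem Pair.row_pred_m_one (h : C.Pair) (hm : 3 ≤ C.m) (hne : C.F 0 ≠ C.F (C.m - 1)) :
    C.R (C.m - 1) 1 = C.F (C.m - 2) := by
  have hq := C.three_le
  have h1 := C.row_pred_m' (j := 1) (by rw [show (1 : ℤ) - 2 = -1 by ring, h.e_neg]; exact hne)
  rcases h1 with h1 | h1
  · exact h1
  by_cases h2 : C.e 2 = C.F (C.m - 1)
  · by_contra hc
    refine h.false_of_split hm hne le_rfl (by omega) ?_ hc (by simp) ?_
    · rw [one_add_one_eq_two, h2]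
      exact hne.symm
    · rw [h1, h.e_one]
      exact fun _ => hne
  · rcases C.row_pred_m (j := 1) h2 with h3 | h3
    · exact h3
    · exact absurd (h3.symm.trans h1) (by simpa using C.e_ne 0)

/-- Otherwise the splittings, used in both orientations of the cycle, leave only `F (m - 2)` in the
row of `x (m - 1)`, against the choice of `m`: for `i ≥ 2` the alternatives `e (i - 1)` and `e i`
exclude each other. -/
theorem Pair.F_zero_eq (h : C.Pair) : C.F 0 = C.F (C.m - 1) := by
  by_contra hne
  have hm : 3 ≤ C.m := by
    have := C.two_le_m
    have := h.m_ne_two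
    omega
  have hq := C.three_le
  obtain ⟨j, hj⟩ := C.exists_R_ne_B (i := C.m - 1) (by omega) (by omega)
  rw [sub_sub] at hj
  have h0 := Int.emod_nonneg j (show C.q ≠ 0 by omega)
  have h1 := Int.emod_lt_of_pos j (show 0 < C.q by omega)
  have hr : C.R (C.m - 1) j = C.R (C.m - 1) (j % C.q) := C.R_eq _ (Int.dvd_self_sub_emod)
  rw [hr] at hj
  generalize j % C.q = i at *
  refine hj ?_
  rcases lt_or_ge i 2 with hi | hi
  · rcases (show i = 0 ∨ i = 1 by omega) with rfl | rfl
    · simpa using h.refl.row_pred_m_one hm hne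
    · exact h.row_pred_m_one hm hne
  · have a1 := h.row_pred_m_of_two_le hm hne hi h1
    have a2 := h.refl.row_pred_m_of_two_le (j := C.q + 1 - i) hm hne (by omega)
      (by rw [refl_q]; omega)
    simp only [refl_m, refl_R, refl_F, refl_e] at a2
    rw [C.R_eq (C.m - 1) (i := 1 - (C.q + 1 - i)) (j := i) ⟨-1, by ring⟩,
      C.e_eq (i := -(C.q + 1 - i - 1)) (j := i) ⟨-1, by ring⟩] at a2
    rcases a1 with a1 | a1
    · exact a1
    rcases a2 with a2 | a2
    · exact a2
    have := C.e_ne (i - 1)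
    rw [sub_add_cancel] at this
    exact absurd (a1.symm.trans a2) this

theorem Pair.flip_iff : C.flip.Pair ↔ C.e (-1) = C.F (C.m - 1) ∧ C.e 1 = C.F (C.m - 1) ∧
    C.R (C.m - 1) 0 = C.e 0 ∧ C.R (C.m - 1) 1 = C.e 0 ∧ C.e 0 ≠ C.F (C.m - 2) := by
  constructor
  · intro h
    have := h.e_neg
    have := h.e_one
    have := h.R_zero
    have := h.R_one
    have := h.ne
    simp_all [sub_sub]
  · rintro ⟨h1, h2, h3, h4, h5⟩
    constructor <;> simp_all [sub_sub]

theorem Pair.flip_refl (h : C.flip.Pair) : C.refl.flip.Pair := by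
  rw [flip_iff] at *
  simp_all

theorem Pair.R_one_ne (h : C.flip.Pair) (he : C.F 0 = C.F (C.m - 1)) :
    C.R 1 0 ≠ C.F 0 ∧ C.R 1 1 ≠ C.F 0 := by
  obtain ⟨h1, h2, -⟩ := flip_iff.1 h
  rw [← he] at h1 h2
  have e0 : C.e 0 ≠ C.F 0 := h2 ▸ C.e_ne 0
  have hF := C.F_zero_ne_one.symm
  constructor
  · rcases C.row_one' (j := 0) (by rw [← h1]; exact C.e_ne _) with h | h <;> rw [h] <;> assumption
  · rcases C.row_one (j := 1) (by rw [← h2]; exact (C.e_ne _).symm) with h | h <;> rw [h]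
    · exact hF
    · simpa using e0

theorem Pair.flip_four_le (h : C.flip.Pair) (he : C.F 0 = C.F (C.m - 1)) : 4 ≤ C.m := by
  have h2 := C.two_le_m
  have hlo := C.lo_le
  have hmh := C.le_hi
  obtain ⟨r0, r1⟩ := h.R_one_ne he
  obtain ⟨p1, p2, p3, p4, p5⟩ := flip_iff.1 h
  by_contra hm
  rcases (show C.m = 2 ∨ C.m = 3 by omega) with hm | hm
  · rw [hm] at he
    exact C.F_zero_ne_one he
  · have hf : C.F 2 = C.F 0 := by rw [he, hm]; rfl
    have hr : C.R 2 0 = C.e 0 := by rw [← p3, hm]; rfl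
    have e0 : C.e 0 ≠ C.F 0 := by
      rw [he, ← p2]
      exact C.e_ne 0
    refine C.insert_cycle (i := 1) (s := 1) (by omega) (by omega) (fun _ => ?_) ?_ (fun _ => ?_) ?_
    · simpa using r1
    · rwa [p2, ← he]
    · simpa [hf, hr] using e0
    · simpa [hr, p1, ← he] using e0

/-- Here the pair sits at the far end: `y q, …, y i` goes between `x 1` and `x 2`, and `y 1, …, y (i
- 1)` between `x (m - 1)` and `x m`. -/
theorem Pair.false_of_flip_split (h : C.flip.Pair) (he : C.F 0 = C.F (C.m - 1)) {i : ℤ} (hi : 2 ≤ i)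
    (hi' : i ≤ C.q) (h1 : 2 < i → C.e (i - 2) ≠ C.F 0) (h2 : C.R 2 i ≠ C.F 2)
    (h3 : i < C.q → C.R 2 i ≠ C.e i) (h4 : i = C.q → C.R 2 i ≠ C.R 1 0) : False := by
  have hm := h.flip_four_le he
  have hlo := C.lo_le
  have hmh := C.le_hi
  have hq := C.three_le
  obtain ⟨r0, r1⟩ := h.R_one_ne he
  obtain ⟨p1, p2, p3, p4, p5⟩ := flip_iff.1 h
  have e0 : C.e 0 ≠ C.F (C.m - 1) := p2 ▸ C.e_ne 0
  have eq1 : C.e (C.q - 1) = C.F 0 := by rw [he, ← p1]; exact C.e_eq ⟨1, by ring⟩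
  have rq : C.R 1 C.q = C.R 1 0 := C.R_eq _ ⟨1, by ring⟩
  have rm : ∀ j, C.R (C.m - 1 + 1) j = C.F (C.m - 1) := by rw [sub_add_cancel]; exact C.R_m
  refine C.insert_two_blocks (C.arc' (a := i) (b := C.q) (by omega) (by omega))
    (C.arc (a := 1) (b := i - 1) (by omega) (by omega)) ?_ ?_ (i := 1) (j := C.m - 1) (by omega)
    (by omega) (by omega) ?_ ?_ ?_ ?_ ?_ ?_ ?_ ?_ ?_ ?_ ?_
  · exact (C.arc_disjoint (by omega) (by omega)).symm
  · rw [union_comm]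
    exact C.arc_union (by omega) (by omega) (by omega) (by omega)
  · rw [rq, sub_self]
    exact fun _ => r0
  · rw [rq, eq1]
    exact fun h => r0 h.2
  · exact fun _ => h2
  · exact fun h => h3 h.1 h.2
  · rw [rq]
    exact fun hq => (h4 (by omega)).symm
  · rw [p4, sub_sub]
    exact fun _ => p5
  · rw [p4, p2]
    exact fun h => e0 h.2
  · rw [rm, sub_add_cancel]
    exact fun h => C.F_pred_m_ne (by omega)
  · rw [rm, ← he, sub_sub]
    exact fun h => h1 (by omega) h.2.symm
  · rw [p4, rm]
    exact fun _ => e0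
  · omega

theorem Pair.flip_R_two_zero (h : C.flip.Pair) (he : C.F 0 = C.F (C.m - 1)) :
    C.R 2 0 = C.F 2 := by
  have hm := h.flip_four_le he
  have hlo := C.lo_le
  have hmh := C.le_hi
  have hq := C.three_le
  obtain ⟨r0, r1⟩ := h.R_one_ne he
  obtain ⟨p1, p2, p3, p4, p5⟩ := flip_iff.1 h
  by_contra hc
  have h1 : C.R 2 0 = C.F 0 := by
    by_contra h0
    refine C.insert_cycle (i := 1) (s := 1) (by omega) (by omega) (fun _ => ?_) ?_
      (fun _ => ?_) ?_
    · simpa using r1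
    · rwa [p2, ← he]
    · simpa using hc
    · norm_num
      rwa [p1, ← he]
  have rq : C.R 2 C.q = C.R 2 0 := C.R_eq _ ⟨1, by ring⟩
  refine h.false_of_flip_split he (i := C.q) (by omega) le_rfl (fun _ => ?_) ?_ ?_ ?_
  · have := C.e_ne (C.q - 2)
    rw [show C.q - 2 + 1 = -1 + C.q by ring, C.e_add, p1, ← he] at this
    exact this
  · rwa [rq]
  · simp
  · rw [rq, h1]
    exact fun _ => r0.symm

theorem Pair.flip_R_two_half (h : C.flip.Pair) (he : C.F 0 = C.F (C.m - 1)) {i : ℤ} (hi : 2 ≤ i)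
    (hi' : i < C.q) : C.R 2 i = C.F 2 ∨ C.R 2 i = C.e i := by
  have hm := h.flip_four_le he
  have hlo := C.lo_le
  have hmh := C.le_hi
  by_contra! hc
  by_cases hi2 : i = 2 ∨ C.e (i - 2) ≠ C.F 0
  · refine h.false_of_flip_split he hi hi'.le (fun _ => ?_) hc.1 (fun _ => hc.2) (by omega)
    exact hi2.resolve_left (by omega)
  -- In the remaining case `e (i - 2) = F 0`, so `R 1 (i - 1) ≠ F 0`, and the whole cycle fits
  -- between `x 1` and `x 2`, entered at `y (i - 1)` and left at `y i`.
  push Not at hi2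
  have e1 : C.e (i - 1) ≠ C.F 0 := by
    have := C.e_ne (i - 2)
    rw [hi2.2, show i - 2 + 1 = i - 1 by ring] at this
    exact this.symm
  have r : C.R 1 (i - 1) ≠ C.F 0 := by
    have := C.e_ne (i - 3)
    rw [show i - 3 + 1 = i - 2 by ring, hi2.2] at this
    rcases C.row_one' (j := i - 1) (by rwa [sub_sub]) with h | h
    · rw [h]
      exact C.F_zero_ne_one.symm
    · rwa [h]
  refine C.insert_cycle' (i := 1) (s := i - 1) (by omega) (by omega) (fun _ => ?_) ?_
    (fun _ => ?_) ?_
  · simpa using r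
  · rwa [sub_sub, one_add_one_eq_two, hi2.2]
  · rw [sub_add_cancel]
    exact hc.1
  · rw [sub_add_cancel]
    exact hc.2

/-- If the two colours agreed, every entry in the row of `x 2` would be `F 2`, which is excluded
because `2 < m`. -/
theorem Pair.flip_F_zero_ne (h : C.flip.Pair) : C.F 0 ≠ C.F (C.m - 1) := by
  intro he
  have hm := h.flip_four_le he
  have hq := C.three_le
  obtain ⟨j, hj⟩ := C.exists_R_ne_F (i := 2) (by omega) (by omega)
  have h0 := Int.emod_nonneg j (show C.q ≠ 0 by omega)
  have h1 := Int.emod_lt_of_pos j (show 0 < C.q by omega)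
  have hr : C.R 2 j = C.R 2 (j % C.q) := C.R_eq _ (Int.dvd_self_sub_emod)
  rw [hr] at hj
  generalize j % C.q = i at *
  refine hj ?_
  rcases lt_or_ge i 2 with hi | hi
  · rcases (show i = 0 ∨ i = 1 by omega) with rfl | rfl
    · exact h.flip_R_two_zero he
    · exact h.flip_refl.flip_R_two_zero he
  · have a1 := h.flip_R_two_half he hi h1
    have a2 := h.flip_refl.flip_R_two_half (i := C.q + 1 - i) he (by omega)
      (by rw [refl_q]; omega)
    simp only [refl_R, refl_F, refl_e] at a2
    rw [C.R_eq 2 (i := 1 - (C.q + 1 - i)) (j := i) ⟨-1, by ring⟩,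
      C.e_eq (i := -(C.q + 1 - i)) (j := i - 1) ⟨-1, by ring⟩] at a2
    rcases a1 with a1 | a1
    · exact a1
    rcases a2 with a2 | a2
    · exact a2
    have := C.e_ne (i - 1)
    rw [sub_add_cancel] at this
    exact absurd (a2.symm.trans a1) this

variable (C)

theorem not_pair : ¬ C.Pair := by
  intro h
  have h1 := h.F_zero_eq
  -- A pair at the near end is a pair at the far end of `C.flip`, where equality of the end colours
  -- is impossible.
  have h2 : C.flip.flip.Pair := by
    constructor <;> simp [h.e_neg, h.e_one, h.R_zero, h.R_one, h.ne]
  have := h2.flip_F_zero_ne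
  simp [h1] at this

/-- Two consecutive equal entries of the first row, on an edge of their own colour, have the
colour of `x 1 x 2`. -/
theorem e_eq_of_pair {j : ℤ} (h1 : C.e (j - 1) = C.F 0) (h2 : C.e (j + 1) = C.F 0)
    (h3 : C.R 1 j = C.e j) (h4 : C.R 1 (j + 1) = C.e j) : C.e j = C.F 1 := by
  by_contra h
  apply (C.shift j).not_pair
  constructor <;> simp only [shift_e, shift_F, shift_R, zero_add]
  · rwa [neg_add_eq_sub]
  · rwa [add_comm]
  · exact h3
  · rwa [add_comm]
  · exact h

/-! ### The colours near `x 0`: good vertices and rigidity -/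

variable {C}

/-- The edge from `x 2` to `y 0` does not have the colour of `x 2 x 3` (if this exists), nor that of
the edge of the cycle preceding `y 0`. -/
structure Good (C : Cfg V κ) : Prop where
  ne_F : 2 < C.hi → C.R 2 0 ≠ C.F 2
  ne_e : C.R 2 0 ≠ C.e (-1)

/-- Goodness removes every obstruction at `x 2` and `y 0` to inserting the cycle between `x 1` and
`x 2`, entered at `y 1`; the obstruction has to be at `x 1` or `y 1`. -/
theorem Good.R_one_one (h : C.Good) : C.R 1 1 = C.F 0 ∨ C.R 1 1 = C.e 1 := by
  by_contra! hc
  have hlo := C.lo_le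
  have h2 := C.two_le_hi
  refine C.insert_cycle (i := 1) (s := 1) (by omega) (by omega) (fun _ => ?_) hc.2 ?_ ?_
  · simpa using hc.1
  · simpa using h.ne_F
  · simpa using h.ne_e

/-- The arcs `y 1, …, y j` and `y (j + 1), …, y q` are placed on the two sides of `x 1`. The
alternatives are the possible clashes at `y j`, `x 1` and `y (j + 1)`; for `j + 1 = q` the second
arc is a single vertex. -/
theorem Good.forward (h : C.Good) (h1 : C.e 1 ≠ C.F 0)
    {j : ℤ} (h1' : j = 1 → C.R 1 1 ≠ C.F 0) (hj : 1 ≤ j) (hj' : j < C.q) :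
    1 < j ∧ C.R 1 j = C.e (j - 1) ∨ C.R 1 (j + 1) = C.R 1 j ∨
      j + 1 < C.q ∧ C.R 1 (j + 1) = C.e (j + 1) ∨
      j + 1 = C.q ∧ C.R 1 C.q = C.R 2 0 := by
  by_contra! hc
  obtain ⟨c1, c2, c3, c4⟩ := hc
  have h2 := C.two_le_hi
  have hlo := C.lo_le
  have hq := C.three_le
  have rq : C.R (1 + 1) C.q = C.R 2 0 := C.R_eq _ ⟨1, by ring⟩
  have eq : C.e (C.q - 1) = C.e (-1) := C.e_eq ⟨1, by ring⟩
  refine C.insert_two_blocks (C.arc (a := 1) (b := j) (by omega) (by omega))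
    (C.arc (a := j + 1) (b := C.q) (by omega) (by omega)) ?_ ?_ (i := 0) (j := 1) (by omega)
    (by omega) (by omega) ?_ ?_ ?_ ?_ ?_ ?_ ?_ ?_ ?_ ?_ ?_
  · exact C.arc_disjoint (by omega) (by omega)
  · exact C.arc_union (by omega) (by omega) (by omega) (by omega)
  · rw [C.R_zero]
    exact C.F_zero_ne_pred
  · rw [C.R_zero]
    exact fun h => h1 h.2.symm
  · omega
  · exact fun h => c1 h.1 h.2
  · intro h
    rw [C.R_zero, show j = 1 by omega]
    exact (h1' (by omega)).symm
  · omega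
  · exact fun h => c3 h.1 h.2
  · rw [rq]
    exact h.ne_F
  · rw [rq, eq]
    exact fun h' => h.ne_e h'.2
  · rw [rq]
    intro h
    rw [show j + 1 = C.q by omega]
    exact c4 (by omega)
  · exact fun _ => c2.symm

/-- The same two arcs as in `Good.forward`, with the first one traversed from `y j` to `y 1`. -/
theorem Good.backward (h : C.Good) (h1 : C.R 1 1 ≠ C.e 1) {j : ℤ} (hj : 2 ≤ j) (hj' : j < C.q)
    (hej : C.e (j - 1) ≠ C.F 0) :
    C.R 1 (j + 1) = C.R 1 1 ∨ j + 1 < C.q ∧ C.R 1 (j + 1) = C.e (j + 1) ∨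
      j + 1 = C.q ∧ C.R 1 C.q = C.R 2 0 := by
  by_contra! hc
  obtain ⟨c2, c3, c4⟩ := hc
  have h2 := C.two_le_hi
  have hlo := C.lo_le
  have hq := C.three_le
  have rq : C.R (1 + 1) C.q = C.R 2 0 := C.R_eq _ ⟨1, by ring⟩
  have eq : C.e (C.q - 1) = C.e (-1) := C.e_eq ⟨1, by ring⟩
  refine C.insert_two_blocks (C.arc' (a := 1) (b := j) (by omega) (by omega))
    (C.arc (a := j + 1) (b := C.q) (by omega) (by omega)) ?_ ?_ (i := 0) (j := 1) (by omega)
    (by omega) (by omega) ?_ ?_ ?_ ?_ ?_ ?_ ?_ ?_ ?_ ?_ ?_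
  · exact C.arc_disjoint (by omega) (by omega)
  · exact C.arc_union (by omega) (by omega) (by omega) (by omega)
  · rw [C.R_zero]
    exact C.F_zero_ne_pred
  · rw [C.R_zero]
    exact fun h => hej h.2.symm
  · omega
  · exact fun h => h1 h.2
  · omega
  · omega
  · exact fun h => c3 h.1 h.2
  · rw [rq]
    exact h.ne_F
  · rw [rq, eq]
    exact fun h' => h.ne_e h'.2
  · rw [rq]
    intro h
    rw [show j + 1 = C.q by omega]
    exact c4 (by omega)
  · exact fun _ => c2.symm

/-- If the edge `x 1 y 1` has the colour of `y 1 y 2`, then so have almost all edges at `x 1`. -/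
theorem Good.row_one_of_eq (h : C.Good) (h1 : C.R 1 1 = C.e 1) {i : ℤ} (hi : 1 ≤ i)
    (hi' : i ≤ C.q - 2) : C.R 1 i = C.F 1 ∧ C.e 1 = C.F 1 := by
  have hα := @C.row_one
  have hα' := @C.row_one'
  have hne := C.e_ne
  have hpair := @C.e_eq_of_pair
  have hF := C.F_zero_ne_one
  have e1 : C.e 1 ≠ C.F 0 := by
    intro he
    have := hne 1
    have := hne 0
    have := @hα 1
    grind
  have hγ := fun j => @Good.forward _ _ _ h e1 j (fun _ => h1 ▸ e1)
  induction i, hi using Int.leInduction with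
  | base =>
    have := @hα 1
    have := @hα 2
    have := @hα' 2
    have := hne 0
    have := hne 1
    have := hne 2
    have := @hpair 1
    have := @hγ 1 (by omega) (by omega)
    grind
  | succ i hi ih =>
    obtain ⟨ih, hg⟩ := ih (by omega)
    refine ⟨?_, hg⟩
    by_contra hc
    have := @hγ i (by omega) (by omega)
    have := @hγ (i + 1) (by omega) (by omega)
    have := @hα (i + 1)
    have := @hα (i + 2)
    have := @hα' (i + 1)
    have := @hα' (i + 2)
    have := @hpair (i + 1)
    have := hne (i - 1)
    have := hne i
    have := hne (i + 1)
    have := hne (i + 2)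
    clear hα hα' hγ hne hpair
    simp only [show i + 1 - 1 = i by ring, show i + 1 + 1 = i + 2 by ring,
      show i + 2 + 1 = i + 3 by ring, show i + 1 - 2 = i - 1 by ring,
      show i + 2 - 2 = i by ring, show i + 2 - 1 = i + 1 by ring,
      show i - 1 + 1 = i by ring] at *
    grind

/-- Equality propagates `F 1` along the row of `x 1` up to `y (q - 2)`. Not all entries can be `F
1`, because `1 < m`; an exception at `y (q - 1)` or `y q` is ruled out by rearrangements. -/
theorem Good.R_one_one_ne (h : C.Good) : C.R 1 1 ≠ C.e 1 := by
  intro h1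
  have hq := C.three_le
  have hlo := C.lo_le
  have h2 := C.two_le_hi
  have hF := C.F_zero_ne_one
  have hrow := fun i => h.row_one_of_eq h1 (i := i)
  have hg := (hrow 1 le_rfl (by omega)).2
  have rq : C.R 2 C.q = C.R 2 0 := C.R_eq _ ⟨1, by ring⟩
  have eq : C.e (C.q - 1) = C.e (-1) := C.e_eq ⟨1, by ring⟩
  have eq' : C.e (C.q + 1) = C.e 1 := C.e_eq ⟨1, by ring⟩
  have hw := h.ne_F
  have hw' := h.ne_e
  rw [← rq] at hw hw'
  rw [← eq] at hw'
  have hγ := fun j => @Good.forward _ _ _ h (by rw [hg]; exact hF.symm) j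
    (fun _ => by rw [h1, hg]; exact hF.symm)
  have hγ1 := @hγ (C.q - 2) (by omega) (by omega)
  have hγ2 := @hγ (C.q - 1) (by omega) (by omega)
  rw [← rq] at hγ1 hγ2
  have hr2 := (hrow (C.q - 2) (by omega) (by omega)).1
  have hr3 := fun h3 : 3 < C.q => (hrow (C.q - 3) (by omega) (by omega)).1
  have a1 := C.row_one (j := C.q - 1)
  have a2 := C.row_one (j := C.q)
  have a3 := C.row_one' (j := C.q - 1)
  have a4 := C.row_one' (j := C.q)
  have hp := C.e_eq_of_pair (j := C.q - 1)
  have n1 := C.e_ne (C.q - 2)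
  have n2 := C.e_ne (C.q - 1)
  have n3 := C.e_ne (C.q - 3)
  simp only [show C.q - 2 + 1 = C.q - 1 by ring, sub_add_cancel, sub_sub,
    show (1 : ℤ) + 1 = 2 by rfl, show (1 : ℤ) + 2 = 3 by rfl, show C.q - 3 + 1 = C.q - 2 by ring,
    show (2 : ℤ) + 1 = 3 by rfl] at *
  by_cases hl : C.R 1 (C.q - 1) = C.F 1
  · have hx : C.R 1 C.q ≠ C.F 1 := by
      intro hx
      obtain ⟨j, hj⟩ := C.exists_R_ne_F (i := 1) (by omega) (by have := C.two_le_m; omega)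
      have h0 := Int.emod_nonneg j (show C.q ≠ 0 by omega)
      have h1 := Int.emod_lt_of_pos j (show 0 < C.q by omega)
      have hr : C.R 1 j = C.R 1 (j % C.q) := C.R_eq _ (Int.dvd_self_sub_emod)
      rw [hr] at hj
      generalize j % C.q = i at *
      rcases (show i = 0 ∨ i = C.q - 1 ∨ 1 ≤ i ∧ i ≤ C.q - 2 by omega) with rfl | rfl | ⟨h3, h4⟩
      · exact hj (by rw [← hx]; exact C.R_eq _ ⟨-1, by ring⟩)
      · exact hj hl
      · exact hj (hrow i h3 h4).1
    grind
  -- The exception is at `y (q - 1)`. The colours are then known well enough to insert the cycle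
  -- between `x 1` and `x 2`, from `y (q - 1)` backwards to `y q`.
  · have e1 : C.R 1 (C.q - 1) = C.e (C.q - 1) := by grind
    have e2 : C.e C.q = C.F 0 := by grind
    have e3 : C.R 1 C.q = C.F 1 := by grind
    have e4 : C.R 2 C.q = C.F 1 := by grind
    refine C.insert_cycle' (i := 1) (s := C.q - 1) (by omega) (by omega) (fun _ => ?_) ?_ ?_ ?_
    · rw [e1, sub_self, ← e2]
      exact n2
    · rw [e1, sub_sub]
      exact n1.symm
    · rw [sub_add_cancel]
      exact hw
    · rw [sub_add_cancel, e2]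
      exact fun h' => hF (h'.symm.trans e4)

/-- Colours of the cycle and of the edges joining it to `x 1` and `x 2` in the case where nothing
can be rearranged near `x 0`. -/
structure Rigid (C : Cfg V κ) : Prop where
  odd : Odd C.q
  e_even : ∀ j, 0 ≤ j → j ≤ C.q - 3 → Even j → C.e j = C.F 1
  e_odd : ∀ j, 0 ≤ j → j ≤ C.q - 2 → Odd j → C.e j = C.F 0
  e_last : C.e (C.q - 1) ≠ C.F 0 ∧ C.e (C.q - 1) ≠ C.F 1
  R_one_zero : C.R 1 0 = C.F 0
  R_one : ∀ j, 1 ≤ j → j < C.q → C.R 1 j = C.F 1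
  R_two_one : C.R 2 1 = C.F 1
  R_two_one_ne : 2 < C.hi → C.R 2 1 ≠ C.F 2

/-- By the previous lemmas `R 1 1 = F 0` and `e 1 ≠ F 0`. The reflection moves the exceptional
vertex `y 1` to `y 0` and the exceptional edge `y 1 y 2` to `y (-1) y 0`. -/
theorem Good.rigid (h : C.Good) : C.refl.Rigid := by
  have hq := C.three_le
  have hlo := C.lo_le
  have h2 := C.two_le_hi
  have hF := C.F_zero_ne_one
  have h0 := h.R_one_one_ne
  have h1 := h.R_one_one.resolve_right h0
  have rq : ∀ i, C.R i C.q = C.R i 0 := fun i => C.R_eq _ ⟨1, by ring⟩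
  have eq : C.e (C.q - 1) = C.e (-1) := C.e_eq ⟨1, by ring⟩
  have eq' : C.e (C.q + 1) = C.e 1 := C.e_eq ⟨1, by ring⟩
  have eq'' : C.e C.q = C.e 0 := C.e_eq ⟨1, by ring⟩
  have hα := @C.row_one
  have hα' := @C.row_one'
  have hne := C.e_ne
  have hpair := @C.e_eq_of_pair
  have e0 : C.e 1 ≠ C.F 0 := fun he => h0 (h1.trans he.symm)
  have e1 : C.e (C.q - 1) = C.F 0 := by
    by_contra hc
    have := @hα' 1 (by rw [← eq.symm] at *; exact hc)
    grind
  have e2 : C.e 2 = C.F 0 := by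
    have := @hα 1
    have := hne (C.q - 1)
    grind
  have rg : C.R 1 C.q = C.F 1 := by
    have := @hα C.q
    have := @hα' C.q
    have := hne (C.q - 1)
    have := hne (C.q - 2)
    have := h.backward h0 (j := C.q - 1) (by omega) (by omega)
    have := h.ne_e
    grind
  have bg : C.R 2 C.q = C.F 1 := by
    have := @hα C.q
    have := @hα' C.q
    have := hne (C.q - 1)
    have := hne (C.q - 2)
    have := h.backward h0 (j := C.q - 1) (by omega) (by omega)
    have := h.ne_e
    grind
  have r2 : C.R 1 2 = C.F 1 := by
    have := @hα 2
    have := @hα' 2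
    have := hne 2
    have := hne (C.q - 1)
    grind
  have hR : ∀ i, 3 ≤ i → i < C.q → C.e (i - 2) ≠ C.F 0 → C.R 1 i = C.e i := by
    intro i hi hi' he
    have := @hα' i he
    have := h.backward h0 (j := i - 1) (by omega) (by omega)
    grind
  have hE : ∀ i, 3 ≤ i → i < C.q → C.e i = C.F 0 → C.e (i - 2) = C.F 0 := by
    intro i hi hi' he
    by_contra hc
    have := hR i hi hi' hc
    have := @hα i
    have := hne (i - 1)
    have := hne i
    grind
  -- From `e (q - 1) = F 0` the colour `F 0` descends in steps of two. For even `q` it would reach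
  -- `e 1`, so `q` is odd.
  have hdown : ∀ n : ℕ, 2 * (n : ℤ) ≤ C.q - 2 → C.e (C.q - 1 - 2 * n) = C.F 0 := by
    intro n
    induction n with
    | zero => simp [e1]
    | succ n ih =>
      intro hn
      push_cast at hn ⊢
      rw [show C.q - 1 - 2 * ((n : ℤ) + 1) = C.q - 1 - 2 * n - 2 by ring]
      exact hE _ (by omega) (by omega) (ih (by omega))
  have hodd : Odd C.q := by
    rw [← Int.not_even_iff_odd]
    rintro ⟨r, hr⟩
    have := hdown (r - 1).toNat (by omega)
    rw [show C.q - 1 - 2 * (((r - 1).toNat : ℕ) : ℤ) = 1 by omega] at this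
    exact e0 this
  obtain ⟨r, hr⟩ := hodd
  have hee : ∀ i, 1 ≤ i → i ≤ r → C.e (2 * i) = C.F 0 := by
    intro i hi hi'
    have := hdown (r - i).toNat (by omega)
    rwa [show C.q - 1 - 2 * (((r - i).toNat : ℕ) : ℤ) = 2 * i by omega] at this
  -- The entry at `2 * i + 1` is the colour of the next cycle edge, by `hR`. If the following entry
  -- equals it, `hpair` gives `F 1`; otherwise that entry is `F 1`, and `Good.forward` forces the
  -- two to agree.
  have hodd : ∀ i, 1 ≤ i → i < r → C.e (2 * i + 1) = C.F 1 ∧ C.R 1 (2 * i + 1) = C.F 1 ∧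
      C.R 1 (2 * i + 2) = C.F 1 := by
    intro i hi hi'
    have b1 := hee i hi hi'.le
    have b2 := hee (i + 1) (by omega) (by omega)
    have := hne (2 * i)
    have := hne (2 * i + 1)
    have := hne (2 * i - 1)
    have := hR (2 * i + 1) (by omega) (by omega)
    have := hne (2 * i + 2)
    have := @hα (2 * i + 2)
    have := @hpair (2 * i + 1)
    have := h.forward e0 (j := 2 * i + 1) (by omega) (by omega) (by omega)
    grind
  have hrow : ∀ j, 2 ≤ j → j ≤ C.q → C.R 1 j = C.F 1 := by
    intro j hj hj'
    rcases Int.even_or_odd' j with ⟨i, rfl | rfl⟩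
    · rcases (show i = 1 ∨ 2 ≤ i by omega) with rfl | hi
      · exact r2
      · have := (hodd (i - 1) (by omega) (by omega)).2.2
        rwa [show 2 * (i - 1) + 2 = 2 * i by ring] at this
    · rcases hj'.eq_or_lt with h' | h'
      · rw [h', rg]
      · exact (hodd i (by omega) (by omega)).2.1
  -- Otherwise `y (q - 1), …, y 2` fits between `x 0` and `x 1`, and `y 1, y 0` between `x 1` and `x
  -- 2`.
  have hc : C.e 0 = C.F 1 := by
    by_contra hc
    have e3 := hne (C.q - 2)
    rw [show C.q - 2 + 1 = C.q - 1 by ring, e1] at e3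
    have ew := hne (C.q - 1)
    rw [sub_add_cancel, e1, eq''] at ew
    have r3 : C.R 1 (C.q + 1) = C.F 0 := by rw [← h1]; exact C.R_eq _ ⟨1, by ring⟩
    refine C.insert_two_blocks (C.arc' (a := 2) (b := C.q - 1) (by omega) (by omega))
      (C.arc' (a := C.q) (b := C.q + 1) (by omega) (by omega)) ?_ ?_ (i := 0) (j := 1) (by omega)
      (by omega) (by omega) ?_ ?_ ?_ ?_ ?_ ?_ ?_ ?_ ?_ ?_ ?_
    · exact C.arc_disjoint (by omega) (by omega)
    · exact C.arc_union (by omega) (by omega) (by omega) (by omega)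
    · rw [C.R_zero]
      exact C.F_zero_ne_pred
    · rw [C.R_zero, sub_sub]
      exact fun h => e3 h.2.symm
    · omega
    · rw [zero_add, r2, e2]
      exact fun h => hF h.2.symm
    · rw [zero_add, r2, C.R_zero]
      exact fun _ => hF
    · omega
    · rw [r3, add_sub_cancel_right, eq'']
      exact fun h => ew h.2
    · rw [one_add_one_eq_two, rq]
      exact h.ne_F
    · rw [one_add_one_eq_two, bg, eq'']
      exact fun h => hc h.2.symm
    · omega
    · rw [r3, r2]
      exact fun _ => hF.symm
  refine ⟨⟨r, hr⟩, ?_, ?_, ?_, ?_, ?_, ?_, ?_⟩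
  · rintro j hj hj' ⟨i, rfl⟩
    simp only [refl_e, refl_F, refl_q] at *
    rcases hj.eq_or_lt with h' | h'
    · rw [← h', neg_zero, hc]
    · rw [← (hodd (r - i) (by omega) (by omega)).1]
      exact C.e_eq ⟨-1, by rw [hr]; ring⟩
  · rintro j hj hj' ⟨i, rfl⟩
    simp only [refl_e, refl_F, refl_q] at *
    rw [← hee (r - i) (by omega) (by omega)]
    exact C.e_eq ⟨-1, by rw [hr]; ring⟩
  · simp only [refl_e, refl_F, refl_q]
    rw [C.e_eq (i := -(C.q - 1)) (j := 1) ⟨-1, by ring⟩]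
    refine ⟨e0, fun he => ?_⟩
    have := hne 0
    rw [hc, zero_add, he] at this
    exact this rfl
  · simpa using h1
  · intro j hj hj'
    simp only [refl_R, refl_F, refl_q] at *
    rw [← hrow (C.q + 1 - j) (by omega) (by omega)]
    exact C.R_eq _ ⟨-1, by ring⟩
  · simp only [refl_R, refl_F, sub_self]
    rw [← rq, bg]
  · simpa using h.ne_F

theorem exists_R_two_ne (C : Cfg V κ) : ∃ w, 2 < C.hi → C.R 2 w ≠ C.F 2 := by
  rcases C.two_le_m.eq_or_lt with hm | hm
  · refine ⟨0, fun hi => ?_⟩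
    have h := C.R_m 0
    rw [← hm] at h
    rw [h]
    exact C.F_ne (i := 1) (by have := C.lo_le; omega) (by omega)
  · obtain ⟨w, hw⟩ := C.exists_R_ne_F (i := 2) (by omega) hm
    exact ⟨w, fun _ => hw⟩

/-- The two cycle edges at `y w` differ in colour, so the edge `x 2 y w` avoids one of them; this
makes `y w` good in one of the two orientations. -/
theorem exists_rigid (C : Cfg V κ) {w : ℤ} (hw : 2 < C.hi → C.R 2 w ≠ C.F 2) :
    (C.shift (w - 1)).Rigid ∨ (C.shift w).refl.Rigid := by
  by_cases h : C.R 2 w = C.e (w - 1)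
  · left
    have h' : C.R 2 w ≠ C.e w := by
      have := C.e_ne (w - 1)
      rw [h]
      rwa [sub_add_cancel] at this
    have hr : (C.shift (w - 1)).refl.refl.Rigid := by
      apply Good.rigid
      constructor
      · simpa using hw
      · simpa using h'
    constructor
    · simpa using hr.odd
    · simpa using hr.e_even
    · simpa using hr.e_odd
    · simpa using hr.e_last
    · simpa using hr.R_one_zero
    · simpa using hr.R_one
    · simpa using hr.R_two_one
    · simpa using hr.R_two_one_ne
  · right
    apply Good.rigid
    constructor
    · simpa using hw
    · simpa [neg_add_eq_sub] using h

theorem Rigid.dvd_of_R_one (h : C.Rigid) {j : ℤ} (hj : C.R 1 j = C.F 0) : C.q ∣ j := by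
  have hq := C.three_le
  have h0 := Int.emod_nonneg j (show C.q ≠ 0 by omega)
  have h1 := Int.emod_lt_of_pos j (show 0 < C.q by omega)
  rw [Int.dvd_iff_emod_eq_zero]
  by_contra hc
  have := h.R_one (j % C.q) (by omega) h1
  rw [← C.R_eq 1 (Int.dvd_self_sub_emod (x := j)), hj] at this
  exact C.F_zero_ne_one this

/-- A second admissible vertex `y j` would give a second rigid frame. The only entry `F 0` in the
row of `x 1` fixes the position of that frame: either `j ≡ 1`, or the exceptional edge would have
colour `F 1`. -/
theorem Rigid.R_two (h : C.Rigid) {j : ℤ} (hj : ¬ C.q ∣ j - 1) : 2 < C.hi ∧ C.R 2 j = C.F 2 := by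
  by_contra hc
  have hF := C.F_zero_ne_one
  rcases C.exists_rigid (w := j) (by tauto) with hr | hr
  · have := hr.R_one_zero
    simp only [shift_R, shift_F, zero_add] at this
    exact hj (h.dvd_of_R_one this)
  · have h1 := hr.R_one_zero
    have h2 := hr.e_even 0 le_rfl (by have := C.three_le; simpa using this) (by simp)
    simp only [refl_R, refl_F, refl_e, shift_e, shift_R, shift_F] at h1 h2
    have h3 := h.dvd_of_R_one h1
    have h4 := h.e_last.2
    refine h4 (h2 ▸ ?_)
    apply C.e_eq
    obtain ⟨l, hl⟩ := h3
    exact ⟨1 - l, by linarith⟩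

theorem Rigid.two_lt_hi (h : C.Rigid) : 2 < C.hi := by
  have hq := C.three_le
  refine (h.R_two (j := 0) fun hd => ?_).1
  have := Int.eq_zero_of_abs_lt_dvd hd (by norm_num; omega)
  omega

theorem Rigid.three_le_m (h : C.Rigid) : 3 ≤ C.m := by
  have hq := C.three_le
  have hm := C.two_le_m
  by_contra hc
  have h2 : C.m = 2 := by omega
  have := h.two_lt_hi
  have h3 := (h.R_two (j := 0) fun hd => ?_).2
  · have h4 := C.R_m 0
    rw [h2, h3] at h4
    exact C.F_ne (i := 1) (by have := C.lo_le; omega) (by omega) h4.symm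
  · have := Int.eq_zero_of_abs_lt_dvd hd (by norm_num; omega)
    omega

/-! ### Excluding rigidity at both ends -/

/-- Both ends of the configuration are rigid, and `y b` and `y b'` are the exceptional vertices of
the cycle for `x (m - 1)` and `x (m - 2)`. -/
structure Opposite (C : Cfg V κ) (b b' : ℤ) : Prop where
  rigid : C.Rigid
  R_m_one : C.R (C.m - 1) b = C.F (C.m - 1)
  R_m_one_of : ∀ j, ¬ C.q ∣ j - b → C.R (C.m - 1) j = C.F (C.m - 2)
  R_m_two : C.R (C.m - 2) b' = C.F (C.m - 2)
  R_m_two_of : ∀ j, ¬ C.q ∣ j - b' → C.R (C.m - 2) j = C.F (C.m - 3)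

theorem Opposite.congr {b b' d d' : ℤ} (h : C.Opposite b b') (hb : C.q ∣ d - b)
    (hb' : C.q ∣ d' - b') : C.Opposite d d' where
  rigid := h.rigid
  R_m_one := (C.R_eq _ hb).trans h.R_m_one
  R_m_one_of j hj := h.R_m_one_of j fun h' => hj (by simpa using dvd_sub h' hb)
  R_m_two := (C.R_eq _ hb').trans h.R_m_two
  R_m_two_of j hj := h.R_m_two_of j fun h' => hj (by simpa using dvd_sub h' hb')

theorem not_dvd_of_abs_lt {q a : ℤ} (ha : a ≠ 0) (h : |a| < q) : ¬ q ∣ a :=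
  fun hd => ha (Int.eq_zero_of_abs_lt_dvd hd h)

variable {b b' : ℤ}

/-- For `m = 3` the row of `x 1`, and for `m = 4` that of `x 2`, is described from both ends. The
descriptions conflict at two vertices of the cycle, of which only one can be the exception `b'`. -/
theorem Opposite.five_le_m (h : C.Opposite b b') : 5 ≤ C.m := by
  have hq := C.three_le
  have hm := h.rigid.three_le_m
  have hlo := C.lo_le
  have hmh := C.le_hi
  by_contra hc
  rcases (show C.m = 3 ∨ C.m = 4 by omega) with hm | hm
  · have key : ∀ j, ¬ C.q ∣ j → C.q ∣ j - b' := by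
      intro j hj
      by_contra hc
      have := h.R_m_two_of j hc
      rw [hm] at this
      exact hj (h.rigid.dvd_of_R_one this)
    have h1 := key 1 (not_dvd_of_abs_lt (by norm_num) (by norm_num; omega))
    have h2 := key 2 (not_dvd_of_abs_lt (by norm_num) (by norm_num; omega))
    have := dvd_sub h2 h1
    rw [sub_sub_sub_cancel_right] at this
    exact not_dvd_of_abs_lt (by norm_num) (by norm_num; omega) this
  · have key : ∀ j, ¬ C.q ∣ j - 1 → C.q ∣ j - b' := by
      intro j hj
      by_contra hc
      have := h.R_m_two_of j hc
      rw [hm] at this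
      have h2 := (h.rigid.R_two hj).2
      exact C.F_ne (i := 1) (by omega) (by omega) (this.symm.trans h2)
    have h1 := key 0 (not_dvd_of_abs_lt (by norm_num) (by norm_num; omega))
    have h2 := key 2 (not_dvd_of_abs_lt (by norm_num) (by norm_num; omega))
    have := dvd_sub h2 h1
    rw [sub_sub_sub_cancel_right] at this
    exact not_dvd_of_abs_lt (by norm_num) (by norm_num; omega) this

/-- The Hamilton path is `…, x 0, y (q - 2), …, y 1, x (m - 2), …, x 1, y 0, y (q - 1), x (m - 1),
…`. -/
theorem Opposite.false_of_eq_zero (h : C.Opposite 0 1) (h1 : C.F (C.m - 1) = C.F 0)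
    (h2 : C.F (C.m - 2) = C.F 1) : False := by
  have hq := C.three_le
  have hm := h.five_le_m
  have hlo := C.lo_le
  have hmh := C.le_hi
  have hF := C.F_zero_ne_one
  obtain ⟨eα, eα'⟩ := h.rigid.e_last
  have e1 : C.e 1 = C.F 0 := h.rigid.e_odd 1 (by omega) (by omega) odd_one
  have eq : C.e (C.q - 3) = C.F 1 := h.rigid.e_even _ (by omega) le_rfl
    (by obtain ⟨r, hr⟩ := h.rigid.odd; exact ⟨r - 1, by omega⟩)
  have rq : C.R 1 C.q = C.F 0 := by
    rw [← h.rigid.R_one_zero]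
    exact C.R_eq _ ⟨1, by ring⟩
  have rl : C.R (C.m - 1) (C.q - 1) = C.F 1 := by
    rw [← h2]
    exact h.R_m_one_of _ (not_dvd_of_abs_lt (by omega) (by rw [abs_lt]; omega))
  refine C.insert_two_blocks_reverse (C.arc' (a := 1) (b := C.q - 2) (by omega) (by omega))
    (C.arc' (a := C.q - 1) (b := C.q) (by omega) (by omega)) ?_ ?_ (i := 0) (j := C.m - 2)
    (by omega) (by omega) (by omega) ?_ ?_ ?_ ?_ ?_ ?_ ?_ ?_ ?_ ?_
  · exact C.arc_disjoint (by omega) (by omega)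
  · exact C.arc_union (by omega) (by omega) (by omega) (by omega)
  · rw [C.R_zero]
    exact C.F_zero_ne_pred
  · rw [C.R_zero, sub_sub, show (2 : ℤ) + 1 = 3 by rfl, eq]
    exact fun h => hF h.2
  · rw [h.R_m_two, sub_sub]
    have := C.F_ne (i := C.m - 3) (by omega) (by omega)
    rw [show C.m - 3 + 1 = C.m - 2 by ring] at this
    exact this.symm
  · rw [h.R_m_two, h2, e1]
    exact fun h => hF h.2.symm
  · rw [C.R_zero, h.R_m_two, h2]
    exact fun _ => hF
  · rw [zero_add, rq]
    exact hF
  · rw [zero_add, rq]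
    exact fun h => eα h.2.symm
  · rw [show C.m - 2 + 1 = C.m - 1 by ring, rl, h1]
    exact fun _ => hF.symm
  · rw [show C.m - 2 + 1 = C.m - 1 by ring, rl]
    exact fun h => eα' h.2.symm
  · omega

theorem Opposite.false_of_eq_last (h : C.Opposite (C.q - 1) (C.q - 2)) (h1 : C.F (C.m - 1) = C.F 1)
    (h2 : C.F (C.m - 2) = C.F 0) (hq : 5 ≤ C.q) : False := by
  have hm := h.five_le_m
  have hlo := C.lo_le
  have hmh := C.le_hi
  have hF := C.F_zero_ne_one
  obtain ⟨eα, eα'⟩ := h.rigid.e_last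
  have e0 : C.e 0 = C.F 1 := h.rigid.e_even 0 (by omega) (by omega) (by simp)
  have e1 : C.e 1 = C.F 0 := h.rigid.e_odd 1 (by omega) (by omega) odd_one
  have e2 : C.e 2 = C.F 1 := h.rigid.e_even 2 (by omega) (by omega) (by simp)
  have eq : C.e (C.q - 3) = C.F 1 := h.rigid.e_even _ (by omega) le_rfl
    (by obtain ⟨r, hr⟩ := h.rigid.odd; exact ⟨r - 1, by omega⟩)
  have rl := h.rigid.R_one (C.q - 1) (by omega) (by omega)
  have f12 : C.F 1 ≠ C.F 2 := C.F_ne (i := 1) (by omega) (by omega)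
  -- The exchange used below gives a cycle of length `m + q - 5`, longer than `q` only for `m > 5`.
  -- For `m = 5` the cycle is inserted between `x 2` and `x 3` instead.
  rcases hm.eq_or_lt with hm | hm
  · have r3 : C.R 3 1 = C.F 2 := by
      have := h.R_m_two_of 1 (not_dvd_of_abs_lt (by omega) (by rw [abs_lt]; omega))
      rwa [← hm] at this
    have f3 : C.F 3 = C.F 0 := by rwa [← hm] at h2
    have f23 : C.F 2 ≠ C.F 3 := C.F_ne (i := 2) (by omega) (by omega)
    have r2 := (h.rigid.R_two (j := 2) (not_dvd_of_abs_lt (by norm_num) (by norm_num; omega))).2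
    refine C.insert_cycle (i := 2) (s := 2) (by omega) (by omega) (fun _ => ?_) ?_ (fun _ => ?_) ?_
    · rw [r2]
      exact f12.symm
    · rw [r2, e2]
      exact f12.symm
    · change C.R 3 1 ≠ C.F 3
      rwa [r3]
    · change C.R 3 1 ≠ C.e 0
      rw [r3, e0]
      exact f12.symm
  · have rq : C.R (C.m - 1) C.q = C.F 0 := by
      rw [← h2]
      exact h.R_m_one_of _ (not_dvd_of_abs_lt (by omega) (by rw [abs_lt]; omega))
    refine C.exchange_blocks (C.arc (a := C.q - 1) (b := C.q) (by omega) (by omega))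
      (C.arc' (a := 1) (b := C.q - 2) (by omega) (by omega)) ?_ ?_ (i := 1) (j := C.m - 2)
      (by omega) (by omega) (by omega) (by omega) ?_ ?_ ?_ ?_ ?_ ?_ ?_ ?_ ?_ ?_
    · exact (C.arc_disjoint (by omega) (by omega)).symm
    · rw [union_comm]
      exact C.arc_union (by omega) (by omega) (by omega) (by omega)
    · rw [rl]
      exact fun _ => hF.symm
    · rw [rl]
      exact fun h => eα' h.2.symm
    · rw [show C.m - 2 + 1 = C.m - 1 by ring, rq, h1]
      exact fun _ => hF
    · rw [show C.m - 2 + 1 = C.m - 1 by ring, rq]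
      exact fun h => eα h.2.symm
    · omega
    · rw [h.R_m_two, sub_sub]
      have := C.F_ne (i := C.m - 3) (by omega) (by omega)
      rw [show C.m - 3 + 1 = C.m - 2 by ring] at this
      exact this.symm
    · rw [h.R_m_two, h2, sub_sub, show (2 : ℤ) + 1 = 3 by rfl, eq]
      exact fun h => hF h.2
    · rw [one_add_one_eq_two, h.rigid.R_two_one]
      exact f12
    · rw [one_add_one_eq_two, h.rigid.R_two_one, e1]
      exact fun h => hF h.2.symm
    · omega

/-- In a triangle there is no room to compare exceptional edges, so the three positions of `b`
modulo `3` are treated separately. The hypothesis `hb` concerns the edge opposite `y b`. -/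
theorem Opposite.false_of_three (h : C.Opposite b b') (hb : C.F (C.m - 1) = C.e (b + 1))
    (hq : C.q = 3) : False := by
  have hm := h.five_le_m
  have hlo := C.lo_le
  have hmh := C.le_hi
  have hF := C.F_zero_ne_one
  have hF' : C.F (C.m - 2) ≠ C.F (C.m - 1) := C.F_pred_pred_m_ne
  obtain ⟨eα, eα'⟩ := h.rigid.e_last
  have e0 : C.e 0 = C.F 1 := h.rigid.e_even 0 (by omega) (by omega) (by simp)
  have e1 : C.e 1 = C.F 0 := h.rigid.e_odd 1 (by omega) (by omega) odd_one
  have e3 : C.e 3 = C.F 1 := by rw [← e0]; exact C.e_eq (by simp [hq])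
  rw [hq] at eα eα'
  norm_num at eα eα'
  have r1 := h.rigid.R_one 1 (by omega) (by omega)
  have r2 := h.rigid.R_one 2 (by omega) (by omega)
  have r0 := h.rigid.R_one_zero
  have rm := C.R_m
  have r3 : C.R 1 3 = C.F 0 := by rw [← r0]; exact C.R_eq _ (by simp [hq])
  have hbm := Int.dvd_self_sub_emod (x := b) (m := 3)
  rw [← hq, ← dvd_neg, neg_sub] at hbm
  have hw := (C.R_eq (C.m - 1) hbm).trans h.R_m_one
  have hb' : C.F (C.m - 1) = C.e (b % C.q + 1) := by
    rw [hb]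
    exact (C.e_eq (by simpa using hbm)).symm
  have c0 := Int.emod_nonneg b (show C.q ≠ 0 by omega)
  have c1 := Int.emod_lt_of_pos b (show 0 < C.q by omega)
  generalize b % C.q = w at *
  rcases (show w = 0 ∨ w = 1 ∨ w = 2 by omega) with rfl | rfl | rfl
  · rw [zero_add, e1] at hb'
    have hw3 : C.R (C.m - 1) 3 = C.F (C.m - 1) := by
      rw [← hw]
      exact C.R_eq _ (by simp [hq])
    refine C.insert_two_blocks_reverse (C.arc (a := 2) (b := 3) (by omega) (by omega))
      (C.arc (a := 1) (b := 1) (by omega) (by omega)) ?_ ?_ (i := 1) (j := C.m - 1)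
      (by omega) (by omega) (by omega) ?_ ?_ ?_ ?_ ?_ ?_ ?_ ?_ ?_ ?_
    · exact (C.arc_disjoint (by omega) (by omega)).symm
    · rw [union_comm]
      exact C.arc_union (by omega) (by omega) (by omega) (by omega)
    · rw [r2]
      exact fun _ => hF.symm
    · rw [r2]
      exact fun h => eα' h.2.symm
    · rw [hw3, sub_sub]
      exact hF'.symm
    · rw [hw3, hb']
      exact fun h => eα h.2.symm
    · omega
    · rw [one_add_one_eq_two, h.rigid.R_two_one]
      exact C.F_ne (i := 1) (by omega) (by omega)
    · simp
    · rw [sub_add_cancel, rm]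
      exact fun h => C.F_pred_m_ne h
    · simp
    · rw [one_add_one_eq_two, h.rigid.R_two_one, sub_add_cancel, rm, hb']
      exact fun _ => hF.symm
  · refine C.exchange_blocks (C.arc (a := 2) (b := 2) (by omega) (by omega))
      (C.arc' (a := 0) (b := 1) (by omega) (by omega)) ?_ ?_ (i := 0) (j := C.m - 1)
      (by omega) (by omega) (by omega) (by omega) ?_ ?_ ?_ ?_ ?_ ?_ ?_ ?_ ?_ ?_
    · exact (C.arc_disjoint (by omega) (by omega)).symm
    · rw [union_comm]
      exact C.arc_union (by omega) (by omega) (by omega) (by omega)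
    · rw [C.R_zero]
      exact C.F_zero_ne_pred
    · simp
    · rw [sub_add_cancel, rm]
      exact fun h => C.F_pred_m_ne h
    · simp
    · rw [sub_add_cancel, rm, C.R_zero, hb']
      exact fun _ h => eα h.symm
    · rw [hw, sub_sub]
      exact hF'.symm
    · rw [hw, hb']
      norm_num
      rwa [e0]
    · rw [zero_add, r0]
      exact hF
    · rw [zero_add, r0, e0]
      exact fun h => hF h.2
    · omega
  · norm_num at hb'
    rw [e3] at hb'
    refine C.exchange_blocks (C.arc (a := 1) (b := 1) (by omega) (by omega))
      (C.arc (a := 2) (b := 3) (by omega) (by omega)) ?_ ?_ (i := 0) (j := C.m - 1)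
      (by omega) (by omega) (by omega) (by omega) ?_ ?_ ?_ ?_ ?_ ?_ ?_ ?_ ?_ ?_
    · exact C.arc_disjoint (by omega) (by omega)
    · exact C.arc_union (by omega) (by omega) (by omega) (by omega)
    · rw [C.R_zero]
      exact C.F_zero_ne_pred
    · simp
    · rw [sub_add_cancel, rm]
      exact fun h => C.F_pred_m_ne h
    · simp
    · rw [sub_add_cancel, rm, C.R_zero, hb']
      exact fun _ => hF
    · rw [hw, sub_sub]
      exact hF'.symm
    · rw [hw, hb']
      exact fun h => eα' h.2.symm
    · rw [zero_add, r3]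
      exact hF
    · rw [zero_add, r3]
      exact fun h => eα h.2.symm
    · omega

theorem Rigid.e_add_two (h : C.Rigid) {j : ℤ} (hj : 0 ≤ j) (hj' : j + 2 ≤ C.q - 2) :
    C.e (j + 2) = C.e j := by
  obtain ⟨r, hr⟩ := h.odd
  rcases Int.even_or_odd j with he | ho
  · have : j + 2 ≤ C.q - 3 := by
      obtain ⟨s, hs⟩ := he
      omega
    rw [h.e_even j hj (by omega) he, h.e_even _ (by omega) this (he.add even_two)]
  · rw [h.e_odd j hj (by omega) ho, h.e_odd _ (by omega) hj' (ho.add_even even_two)]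

/-- Two rigid configurations on the same cycle of length at least five have the same exceptional
edge of the cycle. -/
theorem Rigid.e_ne_of_lt (h : C.Rigid) {D : Cfg V κ} (hD : D.Rigid) (hqD : D.q = C.q)
    (hq : 5 ≤ C.q) {j : ℤ} (hj : 0 ≤ j) (hj' : j ≤ C.q - 2)
    (h1 : D.e (j + 2) = C.e 1 ∨ D.e (j + 2) = C.e (-3))
    (h2 : D.e (j - 2) = C.e 1 ∨ D.e (j - 2) = C.e (-3)) : D.e j ≠ C.e (-1) := by
  intro he
  have e1 : C.e 1 = C.F 0 := h.e_odd 1 (by omega) (by omega) odd_one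
  have e3 : C.e (-3) = C.F 1 := by
    rw [← h.e_even (C.q - 3) (by omega) le_rfl
      (by obtain ⟨r, hr⟩ := h.odd; exact ⟨r - 1, by omega⟩)]
    exact C.e_eq ⟨-1, by ring⟩
  have eα := h.e_last
  rw [C.e_eq (i := C.q - 1) (j := -1) ⟨1, by ring⟩, ← he] at eα
  rw [e1, e3] at h1 h2
  by_cases hl : j + 2 ≤ C.q - 2
  · have := hD.e_add_two hj (by omega)
    grind
  · have := hD.e_add_two (j := j - 2) (by omega) (by omega)
    rw [sub_add_cancel] at this
    grind

/-- Here `t` is the offset between the two rigid frames. For `q ≥ 5` the exceptional edges must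
coincide, so `t ≡ 0`, and comparing cycle edges identifies the path colours at the two ends. -/
theorem Rigid.not_flip_shift (h : C.Rigid) (t : ℤ) : ¬ (C.flip.shift t).Rigid := by
  intro hD
  have hq := C.three_le
  have hO : C.Opposite t (t + 1) := by
    refine ⟨h, ?_, fun j hj => ?_, ?_, fun j hj => ?_⟩
    · simpa using hD.R_one_zero
    · have h0 := Int.emod_nonneg (j - t) (show C.q ≠ 0 by omega)
      have h1 := Int.emod_lt_of_pos (j - t) (show 0 < C.q by omega)
      rw [Int.dvd_iff_emod_eq_zero] at hj
      have := hD.R_one ((j - t) % C.q) (by omega) h1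
      simp only [shift_R, flip_R, shift_F, flip_F, sub_sub, one_add_one_eq_two] at this
      rw [← this]
      apply C.R_eq
      have := Int.dvd_self_sub_emod (x := j - t) (m := C.q)
      convert this using 1
      ring
    · have := hD.R_two_one
      simp only [shift_R, flip_R, shift_F, flip_F, sub_sub, one_add_one_eq_two] at this
      rwa [add_comm]
    · have := (hD.R_two (j := j - t) (by rwa [sub_sub])).2
      simpa [sub_sub] using this
  obtain ⟨r, hr⟩ := h.odd
  have d0 := hD.e_even 0 le_rfl (by simpa using hq) (by simp)
  have d1 := hD.e_odd 1 (by omega) (by rw [shift_q, flip_q]; omega) odd_one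
  simp only [shift_e, flip_e, shift_F, flip_F, sub_sub, zero_add, add_zero,
    one_add_one_eq_two] at d0 d1
  rcases (show C.q = 3 ∨ 5 ≤ C.q by omega) with hq3 | hq5
  · refine hO.false_of_three ?_ hq3
    rw [← d1, add_comm]
  · have c0 := Int.emod_nonneg t (show C.q ≠ 0 by omega)
    have c1 := Int.emod_lt_of_pos t (show 0 < C.q by omega)
    have hdt := Int.dvd_self_sub_emod (x := t) (m := C.q)
    obtain ⟨l, hl⟩ := id hdt
    by_cases ht : t % C.q = 0
    · rw [ht, sub_zero] at hdt
      refine (hO.congr (d := 0) (d' := 1) (by simpa using hdt) (by simpa using hdt)).false_of_eq_zero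
        ?_ ?_
      · rw [← d1, ← h.e_odd 1 (by omega) (by omega) odd_one]
        exact C.e_eq (by simpa using hdt)
      · rw [← d0, ← h.e_even 0 (by omega) (by omega) (by simp)]
        exact C.e_eq (by simpa using hdt)
    · refine h.e_ne_of_lt hD rfl hq5 (j := C.q - 1 - t % C.q) (by omega) (by omega)
        (Or.inl ?_) (Or.inr ?_) ?_ <;> rw [shift_e, flip_e] <;> apply C.e_eq <;>
        exact ⟨l + 1, by linarith⟩

/-- With opposite orientations, coinciding exceptional edges mean `t + 1 ≡ -1`, and the colours `F
0` and `F 1` change roles at the far end. -/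
theorem Rigid.not_flip_refl (h : C.Rigid) (t : ℤ) : ¬ (C.flip.shift t).refl.Rigid := by
  intro hD
  have hq := C.three_le
  have hO : C.Opposite (t + 1) t := by
    refine ⟨h, ?_, fun j hj => ?_, ?_, fun j hj => ?_⟩
    · have := hD.R_one_zero
      simp only [refl_R, refl_F, shift_R, flip_R, shift_F, flip_F, sub_zero] at this
      rwa [add_comm]
    · have h0 := Int.emod_nonneg (t + 1 - j) (show C.q ≠ 0 by omega)
      have h1 := Int.emod_lt_of_pos (t + 1 - j) (show 0 < C.q by omega)
      rw [← dvd_neg, neg_sub, Int.dvd_iff_emod_eq_zero] at hj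
      have := hD.R_one ((t + 1 - j) % C.q) (by omega) h1
      simp only [refl_R, refl_F, shift_R, flip_R, shift_F, flip_F, sub_sub,
        one_add_one_eq_two] at this
      rw [← this]
      apply C.R_eq
      obtain ⟨l, hl⟩ := Int.dvd_self_sub_emod (x := t + 1 - j) (m := C.q)
      exact ⟨-l, by linarith⟩
    · have := hD.R_two_one
      simpa [sub_sub] using this
    · have := (hD.R_two (j := t + 1 - j) (by
        rw [← dvd_neg]
        simp only [refl_q, shift_q, flip_q]
        rwa [show -(t + 1 - j - 1) = j - t by ring])).2
      simp only [refl_R, refl_F, shift_R, flip_R, shift_F, flip_F, sub_sub] at this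
      rwa [show 1 - (t + 1 - j) + t = j by ring, show (1 : ℤ) + 2 = 3 by rfl] at this
  obtain ⟨r, hr⟩ := h.odd
  have d0 := hD.e_even 0 le_rfl (by simpa using hq) (by simp)
  have d1 := hD.e_odd 1 (by omega) (by rw [refl_q, shift_q, flip_q]; omega) odd_one
  simp only [refl_e, refl_F, shift_e, flip_e, shift_F, flip_F, sub_sub, zero_add, add_zero,
    one_add_one_eq_two, neg_zero] at d0 d1
  rcases (show C.q = 3 ∨ 5 ≤ C.q by omega) with hq3 | hq5
  · refine hO.false_of_three ?_ hq3
    rw [← d1]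
    exact C.e_eq ⟨-1, by rw [hq3]; ring⟩
  · have c0 := Int.emod_nonneg (t + 1) (show C.q ≠ 0 by omega)
    have c1 := Int.emod_lt_of_pos (t + 1) (show 0 < C.q by omega)
    obtain ⟨l, hl⟩ := Int.dvd_self_sub_emod (x := t + 1) (m := C.q)
    by_cases ht : (t + 1) % C.q = C.q - 1
    · rw [ht] at hl
      refine (hO.congr (d := C.q - 1) (d' := C.q - 2) ⟨-l, by linarith⟩
        ⟨-l, by linarith⟩).false_of_eq_last ?_ ?_ hq5
      · rw [← d1, ← h.e_even (C.q - 3) (by omega) (by omega) ⟨r - 1, by omega⟩]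
        exact C.e_eq ⟨l, by linarith⟩
      · rw [← d0, ← h.e_odd (C.q - 2) (by omega) (by omega) ⟨r - 1, by omega⟩]
        exact C.e_eq ⟨l, by linarith⟩
    · refine h.e_ne_of_lt hD rfl hq5 (j := (t + 1) % C.q) (by omega) (by omega)
        (Or.inr ?_) (Or.inl ?_) ?_ <;> rw [refl_e, shift_e, flip_e] <;> apply C.e_eq <;>
        exact ⟨l, by linarith⟩

theorem Rigid.elim (h : C.Rigid) : False := by
  obtain ⟨w, hw⟩ := C.flip.exists_R_two_ne
  rcases C.flip.exists_rigid hw with h' | h'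
  · exact h.not_flip_shift _ h'
  · exact h.not_flip_refl _ h'

theorem elim (C : Cfg V κ) : False := by
  obtain ⟨w, hw⟩ := C.exists_R_two_ne
  rcases C.exists_rigid hw with h | h <;> exact h.elim

end Cfg

/-! ### Absorbing the cycles into the path -/

/-- `S` is the vertex set of a properly coloured path. -/
def HasPath (c : V → V → κ) (S : Set V) : Prop := ∃ n s σ t τ, Pth c n S s σ t τ

variable {c : V → V → κ}

/-- The two cycle edges at `y j` differ in colour, so at least one of them can follow the edge from
`t`. -/
theorem Pth.attach (hc : ∀ u v, c u v = c v u) {n S s σ t τ} (h : Pth c n S s σ t τ) {q : ℤ}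
    {y : ℤ → V} (hy : IsCyc c q y) (hd : Disjoint S (range y)) {j : ℤ} (hj : ¬ τ (c t (y j))) :
    HasPath c (S ∪ range y) := by
  have hq := hy.1
  by_cases h1 : c t (y j) = c (y j) (y (j + 1))
  · have := (hy.arc (a := j - q + 1) (b := j) (by omega) (by omega)).reverse hc
    rw [hy.image_Icc (by omega)] at this
    refine ⟨_, _, _, _, _, h.join this hd hj ?_⟩
    rintro ⟨-, h2⟩
    have := hy.2.2 (j - 1)
    rw [sub_add_cancel, show j - 1 + 2 = j + 1 by ring] at this
    exact this (h2.symm.trans h1)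
  · have := hy.arc (a := j) (b := j + q - 1) (by omega) (by omega)
    rw [hy.image_Icc rfl] at this
    exact ⟨_, _, _, _, _, h.join this hd hj fun h' => h1 h'.2⟩

theorem IsCyc.le_ncard {q : ℤ} {y : ℤ → V} (hy : IsCyc c q y) {W : Set V} (hW : W.Finite)
    (h : range y ⊆ W) : q ≤ W.ncard := by
  have hi : InjOn y (Icc 0 (q - 1)) := by
    intro i hi j hj hij
    have h1 := (hy.2.1 i j).1 hij
    simp only [mem_Icc] at hi hj
    have := Int.eq_zero_of_abs_lt_dvd h1 (by rw [abs_lt]; omega)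
    omega
  have h1 := ncard_le_ncard ((hy.image_Icc (a := 0) (b := q - 1) (by ring)).trans_subset h) hW
  rw [hi.ncard_image, ← Nat.card_coe_set_eq, Nat.card_eq_fintype_card, Fintype.card_ofFinset,
    Int.card_Icc] at h1
  omega

/-- A properly coloured path and a disjoint properly coloured cycle can be merged into a properly
coloured path. -/
theorem HasPath.merge (hc : ∀ u v, c u v = c v u) {S : Set V} (hS : HasPath c S) {q : ℤ} {y : ℤ → V}
    (hy : IsCyc c q y) (hd : Disjoint S (range y)) : HasPath c (S ∪ range y) := by
  by_contra hcon
  set W := S ∪ range y with hW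
  have hWf : W.Finite := by
    obtain ⟨n, s, σ, t, τ, hn, x, -, -, -, rfl, -⟩ := hS
    rw [hW, ← hy.image_Icc (a := 0) rfl]
    exact ((finite_Icc _ _).image _).union ((finite_Icc _ _).image _)
  obtain ⟨q, ⟨S, y, hS, hy, hd, hSy⟩, hmax⟩ := Int.exists_greatest_of_bdd
    (P := fun q => ∃ (S : Set V) (y : ℤ → V), HasPath c S ∧ IsCyc c q y ∧ Disjoint S (range y) ∧
      S ∪ range y = W)
    ⟨W.ncard, fun q ⟨S, y, _, hy, _, hSy⟩ => hy.le_ncard hWf (hSy ▸ subset_union_right)⟩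
    ⟨q, S, y, hS, hy, hd, hW⟩
  rw [← hSy] at hcon
  obtain ⟨n, s, σ, t, τ, hn, x, -, -, hinj, rfl, hpc, -⟩ := hS
  have hseg := Pth.seg c x hn hinj hpc
  -- Positivity of `n` comes for free: at a one-vertex path the end predicate never holds, so the
  -- cycle could be attached.
  have hlast : ∀ j, 0 < n ∧ c (x n) (y j) = c (x (n - 1)) (x n) := fun j => by
    by_contra h
    exact hcon (hseg.attach hc hy hd h)
  have hfirst : ∀ j, 0 < n ∧ c (x 0) (y j) = c (x 0) (x (0 + 1)) := fun j => by
    by_contra h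
    exact hcon ((hseg.reverse hc).attach hc hy hd h)
  -- First `m` is chosen least, then `l < m` greatest, so no index strictly between them has either
  -- property; `l` becomes the origin of the configuration.
  obtain ⟨m, ⟨hm0, hmn, hmB⟩, hmin⟩ := Int.exists_least_of_bdd
    (P := fun i => 0 < i ∧ i ≤ n ∧ ∀ j, c (x i) (y j) = c (x (i - 1)) (x i))
    ⟨0, fun i hi => hi.1.le⟩ ⟨n, (hlast 0).1, le_rfl, fun j => (hlast j).2⟩
  obtain ⟨l, ⟨hl0, hlm, hlF⟩, hlmax⟩ := Int.exists_greatest_of_bdd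
    (P := fun i => 0 ≤ i ∧ i < m ∧ ∀ j, c (x i) (y j) = c (x i) (x (i + 1)))
    ⟨m, fun i hi => hi.2.1.le⟩ ⟨0, le_rfl, hm0, fun j => (hfirst j).2⟩
  have him : (fun i => x (i + l)) '' Icc (-l) (n - l) = x '' Icc 0 n := by
    ext v
    simp only [mem_image, mem_Icc]
    constructor
    · rintro ⟨i, hi, rfl⟩
      exact ⟨i + l, by omega, rfl⟩
    · rintro ⟨i, hi, rfl⟩
      exact ⟨i - l, by omega, by simp⟩
  refine Cfg.elim (κ := κ) (V := V)
    { c := c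
      lo := -l
      hi := n - l
      m := m - l
      q := q
      x := fun i => x (i + l)
      y := y
      symm := hc
      lo_le := by omega
      le_hi := by omega
      m_pos := by omega
      inj := ?_
      pcx := ?_
      cyc := hy
      disj := by rwa [him]
      row0 := fun j => ?_
      rowm := fun j => ?_
      rowF := fun i h1 h2 => ?_
      rowB := fun i h1 h2 => ?_
      noHam := fun n s σ t τ h => hcon (by rw [him] at h; exact ⟨_, _, _, _, _, h⟩)
      longest := fun n S s σ t τ q' y' h1 h2 h3 h4 =>
        hmax q' ⟨S, y', ⟨_, _, _, _, _, h1⟩, h2, h3, by rw [h4, him, hSy]⟩ }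
  · intro a ha b hb hab
    simp only [mem_Icc] at ha hb
    have := hinj (by simp only [mem_Icc]; omega) (by simp only [mem_Icc]; omega) hab
    omega
  · intro i h1 h2
    have := hpc (i + l) (by omega) (by omega)
    simpa only [add_right_comm _ l] using this
  · rw [zero_add, hlF, add_comm 1 l]
  · rw [sub_add_cancel, hmB, show m - l - 1 + l = m - 1 by ring]
  · by_contra! h
    have := hlmax (i + l) ⟨by omega, by omega, fun j => by rw [h j, add_right_comm]⟩
    omega
  · by_contra! h
    have := hmin (i + l) ⟨by omega, by omega, fun j => by
      rw [h j, show i - 1 + l = i + l - 1 by ring]⟩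
    omega

theorem HasPath.iUnion {c : V → V → κ} (hc : ∀ u v, c u v = c v u) {S : Set V} (hS : HasPath c S)
    {ι : Type*} (q : ι → ℤ) (y : ι → ℤ → V) (hy : ∀ i, IsCyc c (q i) (y i))
    (hd : ∀ i, Disjoint S (range (y i)))
    (hd' : ∀ i j, i ≠ j → Disjoint (range (y i)) (range (y j))) (s : Finset ι) :
    HasPath c (S ∪ ⋃ i ∈ s, range (y i)) := by
  classical
  induction s using Finset.induction_on with
  | empty => simpa using hS
  | insert a s ha ih =>
    have := ih.merge hc (hy a) ?_
    · rw [union_assoc] at this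
      rwa [Finset.set_biUnion_insert, union_comm (range _)]
    · rw [disjoint_union_left, disjoint_iUnion₂_left]
      exact ⟨hd a, fun i hi => hd' i a fun h => ha (h ▸ hi)⟩

/-! ### Translation from and to walks in the complete graph -/

/-- The colour of an edge of a complete graph, and `none` on the diagonal. -/
noncomputable def colour {K : Type*} (col : (⊤ : SimpleGraph V).EdgeLabeling K) (u v : V) :
    Option K := by
  classical
  exact if h : u ≠ v then some (col ⟨s(u, v), by simpa using h⟩) else none

variable {K : Type*} (col : (⊤ : SimpleGraph V).EdgeLabeling K)

theorem colour_comm (u v : V) : colour col u v = colour col v u := by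
  unfold colour
  by_cases h : u = v
  · simp [h]
  · simp [h, Ne.symm h, Sym2.eq_swap (a := u)]

theorem colour_of_ne {u v : V} (h : u ≠ v) :
    colour col u v = some (col ⟨s(u, v), by simpa using h⟩) := by
  simp [colour, h]

theorem colour_ne_of_mem {H : (⊤ : SimpleGraph V).Subgraph} (hH : H.IsPC col) {u v w : V}
    (h1 : s(u, v) ∈ H.edgeSet) (h2 : s(v, w) ∈ H.edgeSet) (huw : u ≠ w) :
    colour col u v ≠ colour col v w := by
  have e1 := H.edgeSet_subset h1
  have e2 := H.edgeSet_subset h2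
  have h3 : u ≠ v := by simpa using e1
  have h4 : v ≠ w := by simpa using e2
  rw [colour_of_ne col h3, colour_of_ne col h4]
  intro h
  refine hH ⟨_, e1⟩ ⟨_, e2⟩ h1 h2 ?_ ⟨v, by simp, by simp⟩ (Option.some.inj h)
  simp only [ne_eq, Subtype.mk.injEq, Sym2.eq_iff]
  tauto

/-- Proper colouring is assumed for a larger subgraph `G`, so that the lemma also applies to a cycle
with its first edge removed. -/
theorem pth_of_walk {G : (⊤ : SimpleGraph V).Subgraph} (hG : G.IsPC col) {u v : V}
    (p : (⊤ : SimpleGraph V).Walk u v) (hp : p.IsPath) (hpG : p.toSubgraph ≤ G) :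
    Pth (colour col) p.length {a | a ∈ p.support} u (fun a => 0 < p.length ∧ a = colour col u p.snd)
      v (fun a => 0 < p.length ∧ a = colour col p.penultimate v) := by
  have hinj : InjOn (fun i : ℤ => p.getVert i.toNat) (Icc 0 p.length) := by
    intro i hi j hj hij
    simp only [mem_Icc] at hi hj
    have := hp.getVert_injOn (x₁ := i.toNat) (x₂ := j.toNat) (by simp only [mem_ofPred_eq]; omega)
      (by simp only [mem_ofPred_eq]; omega) hij
    omega
  have hadj : ∀ i : ℕ, i < p.length → s(p.getVert i, p.getVert (i + 1)) ∈ G.edgeSet := by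
    intro i hi
    exact SimpleGraph.Subgraph.edgeSet_mono hpG (p.toSubgraph_adj_getVert hi)
  have := Pth.seg (colour col) (fun i : ℤ => p.getVert i.toNat) (i := 0) (j := p.length) (by simp)
    hinj ?_
  · have him : (fun i : ℤ => p.getVert i.toNat) '' Icc 0 p.length = {a | a ∈ p.support} := by
      ext a
      simp only [mem_image, mem_Icc, mem_ofPred_eq, SimpleGraph.Walk.mem_support_iff_exists_getVert]
      constructor
      · rintro ⟨i, hi, rfl⟩
        exact ⟨i.toNat, rfl, by omega⟩
      · rintro ⟨i, rfl, hi⟩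
        exact ⟨i, by omega, by simp⟩
    rw [him] at this
    have h1 : ((p.length : ℤ) - 1).toNat = p.length - 1 := by omega
    simpa [h1, SimpleGraph.Walk.snd, SimpleGraph.Walk.penultimate] using this
  · intro l hl hl'
    obtain ⟨k, rfl⟩ := Int.eq_ofNat_of_zero_le hl
    have k1 : ((k : ℤ) + 1).toNat = k + 1 := by omega
    have k2 : ((k : ℤ) + 2).toNat = k + 2 := by omega
    simp only [k1, k2, Int.toNat_natCast]
    refine colour_ne_of_mem col hG (hadj k (by omega)) (hadj (k + 1) (by omega)) fun h => ?_
    have := hp.getVert_injOn (x₁ := k) (x₂ := k + 2) (by simp only [mem_ofPred_eq]; omega)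
      (by simp only [mem_ofPred_eq]; omega) h
    omega

theorem isCyc_of_walk {v : V} (p : (⊤ : SimpleGraph V).Walk v v) (hp : p.IsCycle)
    (hpc : p.IsPC col) :
    ∃ q y, IsCyc (colour col) q y ∧ range y = {a | a ∈ p.support} := by
  cases p with
  | nil => exact absurd hp (by simp)
  | @cons _ w _ hvw p =>
    have hl := hp.three_le_length
    rw [SimpleGraph.Walk.length_cons] at hl
    obtain ⟨hpath, hedge⟩ := SimpleGraph.Walk.cons_isCycle_iff p hvw |>.1 hp
    have hle : p.toSubgraph ≤ (SimpleGraph.Walk.cons hvw p).toSubgraph := le_sup_right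
    have hnil : ¬ p.Nil := by
      rw [← SimpleGraph.Walk.length_eq_zero_iff]
      omega
    have hs := SimpleGraph.Walk.toSubgraph_adj_snd p hnil
    have ht := SimpleGraph.Walk.toSubgraph_adj_penultimate p hnil
    have hs' := hs
    have ht' := ht
    rw [← SimpleGraph.Subgraph.mem_edgeSet, SimpleGraph.Walk.mem_edges_toSubgraph] at hs' ht'
    have hvw' : s(v, w) ∈ (SimpleGraph.Walk.cons hvw p).toSubgraph.edgeSet := by
      rw [SimpleGraph.Walk.mem_edges_toSubgraph]
      simp
    -- The tail of the cycle is closed by its first edge. A clash would need that edge to occur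
    -- again in the tail, which `hedge` forbids.
    obtain ⟨y, hy, hr⟩ := (pth_of_walk col hpc p hpath hle).close (by omega)
      (by
        rintro ⟨-, h⟩
        refine colour_ne_of_mem col hpc hvw' (SimpleGraph.Subgraph.edgeSet_mono hle hs) ?_ h
        intro (h : v = p.snd)
        rw [← h, Sym2.eq_swap] at hs'
        exact hedge hs')
      (by
        rintro ⟨-, h⟩
        refine colour_ne_of_mem col hpc (SimpleGraph.Subgraph.edgeSet_mono hle ht) hvw' ?_ h.symm
        intro (h : p.penultimate = w)
        rw [h, Sym2.eq_swap] at ht'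
        exact hedge ht')
    refine ⟨_, y, hy, hr.trans ?_⟩
    ext a
    simp only [mem_ofPred_eq, SimpleGraph.Walk.support_cons, List.mem_cons]
    refine ⟨Or.inr, ?_⟩
    rintro (rfl | h)
    · exact p.end_mem_support
    · exact h

theorem exists_walk (x : ℕ → V) (n : ℕ) (hx : InjOn x (Iic n)) :
    ∃ p : (⊤ : SimpleGraph V).Walk (x 0) (x n),
      p.support = (List.range (n + 1)).map x ∧
      p.edges = (List.range n).map (fun i => s(x i, x (i + 1))) := by
  induction n with
  | zero => exact ⟨SimpleGraph.Walk.nil, by simp, by simp⟩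
  | succ n ih =>
    obtain ⟨p, hp, hpe⟩ := ih (hx.mono (Iic_subset_Iic.2 (by omega)))
    have hne : x n ≠ x (n + 1) := fun h => by
      have := hx (by simp) (by simp) h
      omega
    refine ⟨p.concat (by simpa using hne), ?_, ?_⟩
    · rw [SimpleGraph.Walk.support_concat, hp, List.range_succ (n := n + 1)]
      simp
    · rw [SimpleGraph.Walk.edges_concat, hpe, List.range_succ (n := n)]
      simp

theorem HasPath.exists_isHamiltonian [Fintype V] [DecidableEq V]
    (h : HasPath (colour col) univ) :
    ∃ (x y : V) (Q : (⊤ : SimpleGraph V).Walk x y), Q.IsHamiltonian ∧ Q.IsPC col := by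
  obtain ⟨n, s, σ, t, τ, hn, x, -, -, hinj, him, hpc, -⟩ := h
  obtain ⟨n, rfl⟩ := Int.eq_ofNat_of_zero_le hn
  have hx : InjOn (fun i : ℕ => x i) (Iic n) := by
    intro i hi j hj hij
    simp only [mem_Iic] at hi hj
    have := hinj (by simp only [mem_Icc]; omega) (by simp only [mem_Icc]; omega) hij
    omega
  obtain ⟨p, hp, hpe⟩ := exists_walk (fun i : ℕ => x i) n hx
  refine ⟨_, _, p, ?_, ?_⟩
  · have hpath : p.IsPath := by
      rw [SimpleGraph.Walk.isPath_def, hp]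
      refine List.Nodup.map_on (fun i hi j hj hij => hx ?_ ?_ hij) List.nodup_range
      · simp only [List.mem_range] at hi
        simp only [mem_Iic]
        omega
      · simp only [List.mem_range] at hj
        simp only [mem_Iic]
        omega
    rw [hpath.isHamiltonian_iff]
    intro w
    obtain ⟨i, hi, rfl⟩ := him.symm ▸ mem_univ w
    rw [hp, List.mem_map]
    simp only [mem_Icc] at hi
    refine ⟨i.toNat, ?_, ?_⟩
    · rw [List.mem_range]
      omega
    · congr 1
      omega
  · have key : ∀ (i : ℕ) (e f : (⊤ : SimpleGraph V).edgeSet), i + 2 ≤ n →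
        (e : Sym2 V) = s(x i, x (i + 1)) → (f : Sym2 V) = s(x (i + 1), x (i + 2)) →
        col e ≠ col f := by
      rintro i ⟨e, he⟩ ⟨f, hf⟩ hi rfl rfl h
      have := hpc i (by omega) (by omega)
      rw [colour_of_ne col (by simpa using he), colour_of_ne col (by simpa using hf)] at this
      exact this (congrArg some h)
    rintro e f he hf hef ⟨v, hv, hv'⟩
    rw [SimpleGraph.Walk.mem_edges_toSubgraph, hpe, List.mem_map] at he hf
    obtain ⟨i, hi, hie⟩ := he
    obtain ⟨j, hj, hjf⟩ := hf
    rw [List.mem_range] at hi hj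
    rw [← hie, Sym2.mem_iff] at hv
    rw [← hjf, Sym2.mem_iff] at hv'
    have hinj' : ∀ a b : ℕ, a ≤ n → b ≤ n → x a = x b → a = b := fun a b ha hb hab => hx ha hb hab
    have hij : i ≠ j := by
      rintro rfl
      exact hef (Subtype.ext (hie.symm.trans hjf))
    have : j = i + 1 ∨ i = j + 1 := by
      rcases hv with rfl | rfl <;> rcases hv' with hv' | hv' <;>
        have := hinj' _ _ (by omega) (by omega) hv' <;> omega
    rcases this with rfl | rfl
    · exact key i e f (by omega) (by rw [← hie]; push_cast; rfl) (by rw [← hjf]; push_cast; ring_nf)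
    · exact (key j f e (by omega) (by rw [← hjf]; push_cast; rfl)
        (by rw [← hie]; push_cast; ring_nf)).symm

end PCHam

theorem theorem1 {V K : Type*} [Fintype V] [DecidableEq V]
    (col : (⊤ : SimpleGraph V).EdgeLabeling K) (k : ℕ) (u v : V)
    (P : (⊤ : SimpleGraph V).Walk u v)
    (b : Fin k → V) (C : ∀ i : Fin k, (⊤ : SimpleGraph V).Walk (b i) (b i))
    (hPC : SimpleGraph.IsPCPathCycleFactor col P C) :
    ∃ (x y : V) (Q : (⊤ : SimpleGraph V).Walk x y), Q.IsHamiltonian ∧ Q.IsPC col := by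
  have hP := PCHam.pth_of_walk col hPC.path_isPC P hPC.path_isPath le_rfl
  choose q y hy hr using fun i =>
    PCHam.isCyc_of_walk col (C i) (hPC.cycle_isCycle i) (hPC.cycle_isPC i)
  have := PCHam.HasPath.iUnion (PCHam.colour_comm col) ⟨_, _, _, _, _, hP⟩ q y hy
    (fun i => ?_) (fun i j hij => ?_) Finset.univ
  · refine PCHam.HasPath.exists_isHamiltonian col ?_
    convert this
    refine (Set.eq_univ_of_forall fun x => ?_).symm
    rcases hPC.spanning x with h | ⟨i, h⟩
    · exact Or.inl h
    · exact Or.inr (by simpa [hr] using ⟨i, h⟩)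
  · rw [hr, Set.disjoint_left]
    exact fun a h h' => hPC.path_cycle_disjoint i h h'
  · rw [hr, hr, Set.disjoint_left]
    exact fun a h h' => hPC.cycle_cycle_disjoint i j hij h h'
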